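/- **Setting.** $\|\cdot\|$ is the Frobenius norm. A hypercube in $\mathbb R^d$ ($d\ge1$) contains $N$ particles and is subdivided into a balanced $2^d$-tree of depth $L$: every level-$l$ hypercube $C_i^{(l)}$ ($0\le l<L$) is split into $2^d$ congruent hypercubes. The cluster of $C_i^{(l)}$ is the index set of its particles. Fix $\eta>0$ and a switching level $0\le\ell\le L$. Two level-$l$ hypercubes satisfy $\mathrm{adm}_s(C_i,C_j)$ iff $\min(\mathrm{diam}\,C_i,\mathrm{diam}\,C_j)\le\eta\,\mathrm{dist}(C_i,C_j)$. Let $\mathcal{IL}_s(i)$ be the set of $j$ with $\mathrm{adm}_s(C_i,C_j)$ true and $\mathrm{adm}_s$ of the parents false; $\mathcal N_s(i)$ the set of $j\ne i$ with $\mathrm{adm}_s(C_i,C_j)$ false; $\mathcal{IL}_w(i)$ the set of the $2^d-1$ siblings of $i$. The admissible blocks $I\times J$ (index sets of two clusters $i,j$ of one level $l$, both nonempty) are those with $1\le l\le\ell$, $j\in\mathcal{IL}_s(i)$; those with $l=\ell$, $j\in\mathcal N_s(i)$; and those with $\ell<l\le L$, $j\in\mathcal{IL}_w(i)$. With the level-$L$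 diagonal blocks they partition a matrix $H\in\mathbb R^{N\times N}$. **$\widetilde H$.** On a compressed block $\widetilde H_{I,J}=\widetilde U\widetilde V^T$ with at most $p$ columns ($p\ge 1$), $\|H_{I,J}-\widetilde H_{I,J}\|\le\epsilon\|H_{I,J}\|$, in truncated-SVD form up to precision $u$: $\|\widetilde U^T\widetilde U-I\|\le\kappa u$ and $\widetilde V=W\Sigma$ with $\Sigma$ diagonal, $\|W^TW-I\|\le\kappa u$. The diagonal blocks (and, if $\ell=L$, possibly some of the blocks from $\mathcal N_s$) are dense, with $\widetilde H_{I,J}=H_{I,J}$; every other block is compressed. **$\widehat H$ (adaptive precision).** Let $0<u<\epsilon$ and let $\mathcal U$ be a finite set of precisions, all $\ge u$. For each compressed block of level $l$, put $\xi=\|\widetilde H_{I,J}\|/\|\widetilde H\|$ and let $u_{ij}^{(l)}$ be the largest $v\in\{u\}\cup\mathcal U$ with $v\,2^{dl/2}\xi\le\epsilon$ (assumed to exist); $\widehat U,\widehat V$ are $\widetilde U,\widetilde V$ with every entry rounded to precision $u_{ij}^{(l)}$. Dense blocks are rounded entrywise to precision $u$. Rounding to precision $v$ means $a\mapsto a(1+\delta)$,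 $|\delta|\le v$. **Product.** Let $\hat b=\mathrm{fl}(\widehat Hx)$ be computed in the standard model of floating-point arithmetic with unit roundoff $w$ (each product and sum is rounded to precision $w$; sums in any order): start from $b=0$ and, for all blocks of the partition, update $b_I\leftarrow b_I+\widehat U(\widehat V^Tx_J)$, or $b_I\leftarrow b_I+\widehat H_{I,J}x_J$ for dense blocks. **Theorem.** For every $\kappa\ge0$ there is $c>0$, depending only on $\kappa$, such that in every such situation, if $Nw\le\epsilon$ and the second-order terms are negligible in the sense that $\sqrt p\,\epsilon\le c$ and $\sqrt p\,u_{ij}^{(l)}\le c$ for all compressed blocks, then $$\hat b=(H+\Delta H)x\quad\text{for some }\Delta H\text{ with}\quad \|\Delta H\|\le 2\Bigl(2\sqrt{\ell C'+C''+(L-\ell)C'''}+1\Bigr)\,\epsilon\,\|H\|,$$ where $C'=(2^d-1)\bigl(1+2\lceil\sqrt d/\eta\rceil\bigr)^d$, $C''=\bigl(1+2\lceil\sqrt d/\eta\rceil\bigr)^d-1$, $C'''=2^d-1$. -/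

import Mathlib

open scoped Matrix Matrix.Norms.Frobenius

/-! ## The balanced `2^d`-tree -/

/-- A closed axis-parallel hypercube in `ℝ^d`, given by its lowest corner and its side length. -/
structure Hypercube (d : ℕ) where
  corner : EuclideanSpace ℝ (Fin d)
  side : ℝ
  side_pos : 0 < side

/-- The sub-hypercube at level `l` with grid position `i` (one of `2^(d*l)` congruent
sub-hypercubes when every `i k < 2^l`). -/
def Hypercube.box {d : ℕ} (C : Hypercube d) (l : ℕ) (i : Fin d → ℕ) :
    Set (EuclideanSpace ℝ (Fin d)) :=
  {z | ∀ k, C.corner k + C.side / 2 ^ l * i k ≤ z k ∧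
    z k ≤ C.corner k + C.side / 2 ^ l * (i k + 1)}

/-- `i` is the grid position of a hypercube of level `l`. -/
def IsGridIndex {d : ℕ} (l : ℕ) (i : Fin d → ℕ) : Prop := ∀ k, i k < 2 ^ l

/-- Grid position (at level `l - 1`) of the parent of the hypercube at position `i` of level `l`. -/
def parentIdx {d : ℕ} (i : Fin d → ℕ) : Fin d → ℕ := fun k => i k / 2

/-- Interaction list under the weak admissibility condition at level `l`: the `2^d - 1` siblings.
(Other hypercubes of the level are already covered by blocks of coarser levels.) -/
def weakIL {d : ℕ} (l : ℕ) (i : Fin d → ℕ) : Set (Fin d → ℕ) :=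
  {j | IsGridIndex l j ∧ j ≠ i ∧ parentIdx j = parentIdx i}

/-- A balanced `2^d`-tree of depth `L` over `N` particles in a hypercube: every particle is
assigned to one leaf hypercube that contains it (a particle on a common face may be assigned
to either side). Coarser hypercubes and clusters are obtained through ancestors. -/
structure ClusterTree (d N L : ℕ) extends Hypercube d where
  point : Fin N → EuclideanSpace ℝ (Fin d)
  leaf : Fin N → Fin d → ℕ
  leaf_grid : ∀ n, IsGridIndex L (leaf n)
  point_mem : ∀ n, point n ∈ toHypercube.box L (leaf n)

/-- The distance of two sets, `inf {‖x - y‖ : x ∈ X, y ∈ Y}`. -/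
noncomputable def setDist {E : Type*} [PseudoMetricSpace E] (X Y : Set E) : ℝ :=
  sInf (Set.image2 dist X Y)

/-- A candidate block of the matrix: a pair of hypercubes of the same level. -/
structure Block (d : ℕ) where
  level : ℕ
  row : Fin d → ℕ
  col : Fin d → ℕ

/-- Finer adjacent blocks: weak admissibility at levels `ℓ + 1, …, L`. -/
def Block.IsAdjacent {d : ℕ} (L ℓ : ℕ) (B : Block d) : Prop :=
  ℓ + 1 ≤ B.level ∧ B.level ≤ L ∧ IsGridIndex B.level B.row ∧ B.col ∈ weakIL B.level B.row

namespace ClusterTree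

variable {d N L : ℕ} (T : ClusterTree d N L)

/-- The cluster of the hypercube `i` of level `l ≤ L`: the indices of the particles whose leaf
descends from that hypercube. -/
def cluster (l : ℕ) (i : Fin d → ℕ) : Finset (Fin N) :=
  Finset.univ.filter fun n => ∀ k, T.leaf n k / 2 ^ (L - l) = i k

/-- Standard admissibility of two hypercubes of level `l`. -/
def AdmS (η : ℝ) (l : ℕ) (i j : Fin d → ℕ) : Prop :=
  min (Metric.diam (T.box l i)) (Metric.diam (T.box l j)) ≤ η * setDist (T.box l i) (T.box l j)

/-- Interaction list under the standard admissibility condition (used at levels `l ≥ 1`). -/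
def ILs (η : ℝ) (l : ℕ) (i : Fin d → ℕ) : Set (Fin d → ℕ) :=
  {j | IsGridIndex l j ∧ T.AdmS η l i j ∧ ¬ T.AdmS η (l - 1) (parentIdx i) (parentIdx j)}

/-- Neighbor list under the standard admissibility condition. -/
def Ns (η : ℝ) (l : ℕ) (i : Fin d → ℕ) : Set (Fin d → ℕ) :=
  {j | IsGridIndex l j ∧ ¬ T.AdmS η l i j ∧ j ≠ i}

/-- Row index set `I` of a block. -/
def rows (B : Block d) : Finset (Fin N) := T.cluster B.level B.row

/-- Column index set `J` of a block. -/
def cols (B : Block d) : Finset (Fin N) := T.cluster B.level B.col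

/-- Far-field blocks: standard admissibility at levels `1, …, ℓ`. -/
def IsFar (η : ℝ) (ℓ : ℕ) (B : Block d) : Prop :=
  1 ≤ B.level ∧ B.level ≤ ℓ ∧ IsGridIndex B.level B.row ∧ B.col ∈ T.ILs η B.level B.row

/-- Finer neighbor blocks: the neighbors at the switching level `ℓ`. -/
def IsNeighbor (η : ℝ) (ℓ : ℕ) (B : Block d) : Prop :=
  B.level = ℓ ∧ IsGridIndex B.level B.row ∧ B.col ∈ T.Ns η B.level B.row

/-- The (nonempty) blocks admissible under the hybrid admissibility condition. -/
def IsAdmissible (η : ℝ) (ℓ : ℕ) (B : Block d) : Prop :=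
  (T.IsFar η ℓ B ∨ T.IsNeighbor η ℓ B ∨ B.IsAdjacent L ℓ) ∧
    (T.rows B).Nonempty ∧ (T.cols B).Nonempty

/-- The (nonempty) diagonal blocks at the leaf level. -/
def IsDiagonal (B : Block d) : Prop :=
  B.level = L ∧ IsGridIndex L B.row ∧ B.col = B.row ∧ (T.rows B).Nonempty

/-- All (nonempty) blocks of the hybrid block partition with switching level `ℓ`. -/
def IsBlock (η : ℝ) (ℓ : ℕ) (B : Block d) : Prop :=
  T.IsAdmissible η ℓ B ∨ T.IsDiagonal B

/-- The submatrix `H_{I,J}` of a block. -/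
def sub (H : Matrix (Fin N) (Fin N) ℝ) (B : Block d) : Matrix (T.rows B) (T.cols B) ℝ :=
  H.submatrix Subtype.val Subtype.val

end ClusterTree

/-! ## Hybrid hierarchical matrices -/

/-- The storage format: which blocks are kept in dense form, and the number of columns of the
low-rank factors of the others. -/
structure HhFormat (d : ℕ) where
  dense : Set (Block d)
  rank : Block d → ℕ

/-- The stored data of a hierarchical matrix: low-rank factors `U`, `V` for compressed blocks
and entries `D` for dense blocks (only the relevant one of the two is ever used). -/
structure HhRep {d N L : ℕ} (T : ClusterTree d N L) (F : HhFormat d) where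
  U : (B : Block d) → Matrix (T.rows B) (Fin (F.rank B)) ℝ
  V : (B : Block d) → Matrix (T.cols B) (Fin (F.rank B)) ℝ
  D : (B : Block d) → Matrix (T.rows B) (T.cols B) ℝ

open Classical in
/-- The matrix block that the stored data represent. -/
noncomputable def HhRep.block {d N L : ℕ} {T : ClusterTree d N L} {F : HhFormat d}
    (R : HhRep T F) (B : Block d) : Matrix (T.rows B) (T.cols B) ℝ :=
  if B ∈ F.dense then R.D B else R.U B * (R.V B)ᵀ

/-- `R` is a hybrid hierarchical representation of `H` with switching level `ℓ`, rank bound `p`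
and target accuracy `ε`, and `Ht` is the matrix it represents. Compressed blocks come
from truncated singular value decompositions computed in precision `u`: `U` has columns
orthonormal to precision `u`, and `V = W Σ` with `Σ` diagonal and the columns of `W` orthonormal to
precision `u`. Diagonal leaf blocks are dense; if `ℓ = L`, any of the neighbor blocks may
be dense as well. -/
structure IsHhMatrix {d N L : ℕ} (T : ClusterTree d N L) (F : HhFormat d) (η : ℝ) (ℓ p : ℕ)
    (ε κ u : ℝ) (H Ht : Matrix (Fin N) (Fin N) ℝ) (R : HhRep T F) : Prop where
  assemble : ∀ B, T.IsBlock η ℓ B → T.sub Ht B = R.block B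
  diagonal_dense : ∀ B, T.IsDiagonal B → B ∈ F.dense
  dense_admissible : ∀ B, T.IsAdmissible η ℓ B → B ∈ F.dense → T.IsNeighbor η ℓ B ∧ ℓ = L
  dense_eq : ∀ B, T.IsBlock η ℓ B → B ∈ F.dense → R.D B = T.sub H B
  rank_le : ∀ B, T.IsAdmissible η ℓ B → B ∉ F.dense → F.rank B ≤ p
  accuracy : ∀ B, T.IsAdmissible η ℓ B → B ∉ F.dense →
    ‖T.sub H B - R.U B * (R.V B)ᵀ‖ ≤ ε * ‖T.sub H B‖
  left_orthonormal : ∀ B, T.IsAdmissible η ℓ B → B ∉ F.dense →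
    ‖(R.U B)ᵀ * R.U B - 1‖ ≤ κ * u
  right_svd : ∀ B, T.IsAdmissible η ℓ B → B ∉ F.dense →
    ∃ (W : Matrix (T.cols B) (Fin (F.rank B)) ℝ) (σ : Fin (F.rank B) → ℝ),
      R.V B = W * Matrix.diagonal σ ∧ ‖Wᵀ * W - 1‖ ≤ κ * u

/-! ## Floating-point arithmetic and the adaptive mixed precision representation -/

/-- Standard model of floating-point arithmetic: `b = a (1 + δ)` with `|δ| ≤ u`. -/
def Rounded (u a b : ℝ) : Prop := ∃ δ : ℝ, |δ| ≤ u ∧ b = a * (1 + δ)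

/-- `Rh` with block precisions `prec` is the adaptive mixed precision representation obtained from
the representation `R` of `Ht`. For a compressed block of level `l`, with
`ξ = ‖Ht_{I,J}‖ / ‖Ht‖`, the precision is the largest `v ∈ {u} ∪ 𝒰` with
`v ≤ ε / (2^(d l / 2) ξ)` (no restriction if `ξ = 0`), and both factors are rounded to it; dense
blocks are stored in precision `u`. -/
structure IsAdaptive {d N L : ℕ} (T : ClusterTree d N L) (F : HhFormat d) (η : ℝ) (ℓ : ℕ)
    (ε u : ℝ) (𝒰 : Finset ℝ) (Ht : Matrix (Fin N) (Fin N) ℝ) (R Rh : HhRep T F)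
    (prec : Block d → ℝ) : Prop where
  precision : ∀ B, T.IsAdmissible η ℓ B → B ∉ F.dense →
    IsGreatest {v : ℝ | (v = u ∨ v ∈ 𝒰) ∧
      v * ((2 : ℝ) ^ ((d * B.level : ℝ) / 2) * (‖T.sub Ht B‖ / ‖Ht‖)) ≤ ε} (prec B)
  round_U : ∀ B, T.IsAdmissible η ℓ B → B ∉ F.dense →
    ∀ a k, Rounded (prec B) (R.U B a k) (Rh.U B a k)
  round_V : ∀ B, T.IsAdmissible η ℓ B → B ∉ F.dense →
    ∀ a k, Rounded (prec B) (R.V B a k) (Rh.V B a k)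
  round_D : ∀ B, T.IsBlock η ℓ B → B ∈ F.dense →
    ∀ a a', Rounded u (R.D B a a') (Rh.D B a a')

/-! ## The matrix-vector product in floating-point arithmetic -/

/-- `FlSum u t s y`: `y` is a possible computed value, in precision `u`, of `∑ i ∈ s, t i`, the
terms being added two partial sums at a time in any order. -/
inductive FlSum {ι : Type*} (u : ℝ) (t : ι → ℝ) : Set ι → ℝ → Prop
  | empty : FlSum u t ∅ 0
  | single (i : ι) : FlSum u t {i} (t i)
  | add {s₁ s₂ : Set ι} {y₁ y₂ y : ℝ} : s₁.Nonempty → s₂.Nonempty → Disjoint s₁ s₂ →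
      FlSum u t s₁ y₁ → FlSum u t s₂ y₂ → Rounded u (y₁ + y₂) y → FlSum u t (s₁ ∪ s₂) y

/-- `y` is a possible computed value of the matrix-vector product `A x` in precision `u`: all
products and all additions are rounded. -/
def FlMulVec {ι κ : Type*} (u : ℝ) (A : Matrix ι κ ℝ) (x : κ → ℝ) (y : ι → ℝ) : Prop :=
  ∀ i, ∃ t : κ → ℝ, (∀ j, Rounded u (A i j * x j) (t j)) ∧ FlSum u t Set.univ (y i)

/-- `y` is a possible computed value of block times `x_J`: for a compressed block
`U (Vᵀ x_J)` (first `Vᵀ x_J`, then the product with `U`), for a dense block `D x_J`. -/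
def HhRep.FlBlockMul {d N L : ℕ} {T : ClusterTree d N L} {F : HhFormat d} (R : HhRep T F)
    (u : ℝ) (x : Fin N → ℝ) (B : Block d) (y : T.rows B → ℝ) : Prop :=
  (B ∈ F.dense ∧ FlMulVec u (R.D B) (fun j => x j) y) ∨
  (B ∉ F.dense ∧ ∃ z : Fin (F.rank B) → ℝ,
    FlMulVec u (R.V B)ᵀ (fun j => x j) z ∧ FlMulVec u (R.U B) z y)

/-- `R.FlRun u x bs b`: starting from `0` and processing the blocks of the list `bs` (its head is
processed last) by the updates `b_I ← b_I + (block) x_J` in precision `u`, one can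
arrive at the vector `b`. -/
inductive HhRep.FlRun {d N L : ℕ} {T : ClusterTree d N L} {F : HhFormat d} (R : HhRep T F)
    (u : ℝ) (x : Fin N → ℝ) : List (Block d) → (Fin N → ℝ) → Prop
  | start : R.FlRun u x [] 0
  | step {bs : List (Block d)} {b b' : Fin N → ℝ} {B : Block d} {y : T.rows B → ℝ} :
      R.FlRun u x bs b → R.FlBlockMul u x B y →
      (∀ r : T.rows B, Rounded u (b r + y r) (b' r)) →
      (∀ r : Fin N, r ∉ T.rows B → b' r = b r) → R.FlRun u x (B :: bs) b'

/-- `b` is a possible result of the hierarchical matrix-vector product with `R` in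
precision `u`: every block of the partition is processed exactly once, in any order (in
particular level by level, the diagonal blocks last). -/
def HhRep.FlProduct {d N L : ℕ} {T : ClusterTree d N L} {F : HhFormat d} (R : HhRep T F)
    (η : ℝ) (ℓ : ℕ) (u : ℝ) (x b : Fin N → ℝ) : Prop :=
  ∃ bs : List (Block d), bs.Nodup ∧ (∀ B, B ∈ bs ↔ T.IsBlock η ℓ B) ∧ R.FlRun u x bs b

/-! ## The constants -/

/-- The constant `C'`, bounding the size of the lists `ILs`. -/
noncomputable def constFar (d : ℕ) (η : ℝ) : ℝ :=
  (2 ^ d - 1) * (1 + 2 * (⌈√(d : ℝ) / η⌉₊ : ℝ)) ^ d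

/-- The constant `C''`, bounding the size of the lists `Ns`. -/
noncomputable def constNeighbor (d : ℕ) (η : ℝ) : ℝ :=
  (1 + 2 * (⌈√(d : ℝ) / η⌉₊ : ℝ)) ^ d - 1

/-- The constant `C'''`, the size of the lists `weakIL`. -/
noncomputable def constAdjacent (d : ℕ) : ℝ := 2 ^ d - 1

/-! A forward bound on the residual `r = b - H x` by `C ‖x‖` suffices: the rank-one matrix `r xᵀ /
‖x‖²` turns the residual into a perturbation of norm at most `C` (`exists_mulVec_eq_of_vecNorm_le`).

On a compressed block of precision `q`, relative to `‖x_J‖` and to first order, rounding the two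
factors costs `2 q ‖Ht_{I,J}‖`, the arithmetic costs `ε ‖Ht_{I,J}‖`, and truncation costs `ε
‖H_{I,J}‖`. The SVD form keeps `√p` out of these terms: it enters only through products of two
rounding errors (`vecNorm_lowRank_sub_le`). The choice of precision gives `q ‖Ht_{I,J}‖ ≤ ε
2^(-dl/2) ‖Ht‖`, so the error of a block is about `2 ε 2^(-dl/2) ‖H‖ + 2 ε ‖H_{I,J}‖`
(`vecNorm_block_error_le`). Accumulation of the block products adds about `ε ‖H_{I,J}‖`.

Block errors add in squares: the blocks meeting a fixed row have column sets that partition all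
indices, so Cauchy–Schwarz in each row bounds the total by the root of the sum of squares
(`ClusterTree.vecNorm_sum_extend_le`). The norms `‖H_{I,J}‖` then sum in squares to `‖H‖²`. The
weights `2^(-dl/2)` do so to at most `2 K`, where `K = ℓ C' + C'' + (L - ℓ) C'''`: a level has at
most `2^(dl)` block rows with boundedly many blocks each, so every level contributes a constant
(`ClusterTree.sum_admissible_le_two_mul`).

Minkowski gives about `(2 √(2K) + 3) ε ‖H‖`. Since `K ≥ 2`, the gap between `2 √2` and `4` absorbs
the excess over `4 √K + 2` as well as all second-order terms. -/

/-! ## Euclidean and Frobenius norms -/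

section Norms

variable {ι m n : Type*} [Fintype ι] [Fintype m] [Fintype n]

/-- The Euclidean norm of a real vector. -/
noncomputable def vecNorm (v : ι → ℝ) : ℝ := ‖WithLp.toLp 2 v‖

theorem vecNorm_nonneg (v : ι → ℝ) : 0 ≤ vecNorm v := norm_nonneg _

theorem vecNorm_sq (v : ι → ℝ) : vecNorm v ^ 2 = ∑ i, v i ^ 2 := by
  simp [vecNorm, EuclideanSpace.real_norm_sq_eq]

theorem vecNorm_le_iff {v : ι → ℝ} {c : ℝ} (hc : 0 ≤ c) :
    vecNorm v ≤ c ↔ ∑ i, v i ^ 2 ≤ c ^ 2 := by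
  rw [← vecNorm_sq, sq_le_sq₀ (vecNorm_nonneg v) hc]

theorem vecNorm_add_le (v w : ι → ℝ) : vecNorm (v + w) ≤ vecNorm v + vecNorm w := by
  simpa [vecNorm] using norm_add_le (WithLp.toLp 2 v) (WithLp.toLp 2 w)

theorem vecNorm_sum_le {α : Type*} (s : Finset α) (f : α → ι → ℝ) :
    vecNorm (fun i => ∑ a ∈ s, f a i) ≤ ∑ a ∈ s, vecNorm (f a) := by
  classical
  induction s using Finset.induction_on with
  | empty => simp [vecNorm_le_iff]
  | insert a s ha ih =>
    simp only [Finset.sum_insert ha]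
    exact (vecNorm_add_le (f a) _).trans (by gcongr)

theorem vecNorm_smul (c : ℝ) (v : ι → ℝ) : vecNorm (fun i => c * v i) = |c| * vecNorm v := by
  have := norm_smul c (WithLp.toLp 2 v)
  simpa [vecNorm, ← WithLp.toLp_smul, Pi.smul_def] using this

theorem vecNorm_mono {v w : ι → ℝ} (h : ∀ i, |v i| ≤ |w i|) : vecNorm v ≤ vecNorm w := by
  rw [vecNorm_le_iff (vecNorm_nonneg w), vecNorm_sq]
  exact Finset.sum_le_sum fun i _ => sq_le_sq.2 (h i)

theorem vecNorm_abs (v : ι → ℝ) : vecNorm (fun i => |v i|) = vecNorm v :=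
  le_antisymm (vecNorm_mono fun i => by simp) (vecNorm_mono fun i => by simp)

theorem sum_mul_le_vecNorm (v w : ι → ℝ) : ∑ i, v i * w i ≤ vecNorm v * vecNorm w := by
  refine abs_le_of_sq_le_sq' ?_ (mul_nonneg (vecNorm_nonneg v) (vecNorm_nonneg w)) |>.2
  rw [mul_pow, vecNorm_sq, vecNorm_sq]
  exact Finset.sum_mul_sq_le_sq_mul_sq _ _ _

theorem sum_abs_mul_abs_le_vecNorm (v w : ι → ℝ) :
    ∑ i, |v i| * |w i| ≤ vecNorm v * vecNorm w := by
  simpa [vecNorm_abs] using sum_mul_le_vecNorm (fun i => |v i|) (fun i => |w i|)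

theorem sum_abs_le_sqrt_card_mul_vecNorm (v : ι → ℝ) :
    ∑ i, |v i| ≤ √(Fintype.card ι : ℝ) * vecNorm v := by
  have h1 : vecNorm (fun _ : ι => (1 : ℝ)) = √(Fintype.card ι : ℝ) := by
    rw [← Real.sqrt_sq (vecNorm_nonneg _), vecNorm_sq]; simp
  simpa [h1] using sum_abs_mul_abs_le_vecNorm (fun _ : ι => (1 : ℝ)) v

theorem frobenius_norm_sq (A : Matrix m n ℝ) : ‖A‖ ^ 2 = ∑ i, ∑ j, A i j ^ 2 := by
  rw [Matrix.frobenius_norm_def, ← Real.sqrt_eq_rpow, Real.sq_sqrt (by positivity)]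
  simp

theorem frobenius_norm_sq_rows (A : Matrix m n ℝ) : ‖A‖ ^ 2 = ∑ i, vecNorm (A i) ^ 2 := by
  simp_rw [frobenius_norm_sq, vecNorm_sq]

theorem frobenius_norm_sq_cols (A : Matrix m n ℝ) :
    ‖A‖ ^ 2 = ∑ j, vecNorm (fun i => A i j) ^ 2 := by
  simp_rw [frobenius_norm_sq, vecNorm_sq]
  exact Finset.sum_comm

theorem vecNorm_abs_mulVec_le (A : Matrix m n ℝ) (x : n → ℝ) :
    vecNorm (fun i => ∑ j, |A i j| * |x j|) ≤ ‖A‖ * vecNorm x := by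
  rw [vecNorm_le_iff (mul_nonneg (norm_nonneg _) (vecNorm_nonneg _)), mul_pow,
    frobenius_norm_sq_rows, Finset.sum_mul]
  refine Finset.sum_le_sum fun i _ => ?_
  rw [← mul_pow]
  exact pow_le_pow_left₀ (by positivity) (sum_abs_mul_abs_le_vecNorm _ _) 2

theorem vecNorm_mulVec_le (A : Matrix m n ℝ) (x : n → ℝ) :
    vecNorm (A *ᵥ x) ≤ ‖A‖ * vecNorm x := by
  refine (vecNorm_mono fun i => ?_).trans (vecNorm_abs_mulVec_le A x)
  rw [abs_of_nonneg (Finset.sum_nonneg fun _ _ => by positivity : (0 : ℝ) ≤ ∑ j, |A i j| * |x j|)]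
  simpa only [Matrix.mulVec, dotProduct, abs_mul] using
    Finset.abs_sum_le_sum_abs (fun j => A i j * x j) Finset.univ

theorem vecNorm_sq_eq_dotProduct (v : ι → ℝ) : vecNorm v ^ 2 = v ⬝ᵥ v := by
  rw [vecNorm_sq]; simp [dotProduct, sq]

/-- A residual vector is a rank-one perturbation of the matrix. -/
theorem exists_mulVec_eq_of_vecNorm_le {r : m → ℝ} {x : n → ℝ} {C : ℝ} (hC : 0 ≤ C)
    (h : vecNorm r ≤ C * vecNorm x) : ∃ E : Matrix m n ℝ, E *ᵥ x = r ∧ ‖E‖ ≤ C := by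
  rcases (vecNorm_nonneg x).eq_or_lt with hx | hx
  · refine ⟨0, ?_, by simpa using hC⟩
    rw [← hx, mul_zero] at h
    have h0 : ∑ i, r i ^ 2 ≤ 0 := by simpa using (vecNorm_le_iff le_rfl).1 h
    have := (Finset.sum_eq_zero_iff_of_nonneg fun i _ => sq_nonneg (r i)).1
      (le_antisymm h0 (Finset.sum_nonneg fun i _ => sq_nonneg (r i)))
    funext i
    simpa using (pow_eq_zero_iff two_ne_zero).1 (this i (Finset.mem_univ i)) |>.symm
  · refine ⟨Matrix.of fun i j => r i * x j / vecNorm x ^ 2, ?_, ?_⟩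
    · funext i
      have : ∑ j, r i * x j / vecNorm x ^ 2 * x j = r i * (∑ j, x j ^ 2) / vecNorm x ^ 2 := by
        rw [Finset.mul_sum, Finset.sum_div]
        exact Finset.sum_congr rfl fun j _ => by ring
      simp only [Matrix.mulVec, dotProduct, Matrix.of_apply, this, ← vecNorm_sq]
      field_simp
    · refine (sq_le_sq₀ (norm_nonneg _) hC).1 ?_
      have hs : ‖(Matrix.of fun i j => r i * x j / vecNorm x ^ 2 : Matrix m n ℝ)‖ ^ 2 =
          vecNorm r ^ 2 * vecNorm x ^ 2 / vecNorm x ^ 4 := by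
        rw [frobenius_norm_sq, vecNorm_sq r, Finset.sum_mul, Finset.sum_div]
        refine Finset.sum_congr rfl fun i _ => ?_
        conv_rhs => rw [vecNorm_sq x, Finset.mul_sum, Finset.sum_div]
        refine Finset.sum_congr rfl fun j _ => ?_
        simp only [Matrix.of_apply]
        rw [div_pow]; ring
      rw [hs, div_le_iff₀ (by positivity)]
      have := pow_le_pow_left₀ (vecNorm_nonneg r) h 2
      nlinarith [sq_nonneg (vecNorm x)]

end Norms

/-! ## Rounding errors of sums and matrix-vector products -/

section Rounding

variable {ι κ : Type*} [Fintype κ]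

theorem Rounded.abs_sub_le {u a b : ℝ} (h : Rounded u a b) : |b - a| ≤ u * |a| := by
  obtain ⟨δ, hδ, rfl⟩ := h
  rw [show a * (1 + δ) - a = δ * a by ring, abs_mul]
  gcongr

theorem one_le_one_add_pow {w : ℝ} (hw : 0 ≤ w) (n : ℕ) : 1 ≤ (1 + w) ^ n :=
  one_le_pow₀ (by linarith)

theorem one_add_pow_sub_one_le {w t : ℝ} (hw : 0 ≤ w) {n : ℕ} (hn : n * w ≤ t) (ht : t ≤ 1) :
    (1 + w) ^ n - 1 ≤ t * (1 + t) := by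
  have h0 : 0 ≤ n * w := by positivity
  have h1 : (1 + w) ^ n ≤ Real.exp (n * w) := by
    rw [Real.exp_nat_mul]
    gcongr
    linarith [Real.add_one_le_exp w]
  have h2 := (abs_le.1 (Real.abs_exp_sub_one_sub_id_le (abs_le.2 ⟨by linarith, hn.trans ht⟩))).2
  nlinarith

/-- In any order of summation, a term passes through at most `n - 1` rounded additions. The
induction follows the tree of additions. -/
theorem FlSum.abs_sub_le {w : ℝ} (hw : 0 ≤ w) {t : κ → ℝ} {s : Set κ} {y : ℝ}
    (h : FlSum w t s y) :
    |y - ∑ i, s.indicator t i| ≤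
      ((1 + w) ^ (s.ncard - 1) - 1) * ∑ i, s.indicator (fun i => |t i|) i := by
  classical
  induction h with
  | empty => simp
  | single i => simp [Set.indicator_apply]
  | @add s₁ s₂ y₁ y₂ y n₁ n₂ hd _ _ hr ih₁ ih₂ =>
    have hc : (s₁ ∪ s₂).ncard = s₁.ncard + s₂.ncard :=
      Set.ncard_union_eq hd (Set.toFinite _) (Set.toFinite _)
    have p₁ : 0 < s₁.ncard := (Set.ncard_pos (Set.toFinite _)).2 n₁
    have p₂ : 0 < s₂.ncard := (Set.ncard_pos (Set.toFinite _)).2 n₂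
    -- As both parts are nonempty, `k` bounds the exponents of both; the new rounding supplies the
    -- remaining factor `1 + w`.
    set k := s₁.ncard + s₂.ncard - 2 with hk
    have hk1 : (1 + w) ^ (s₁.ncard - 1) ≤ (1 + w) ^ k :=
      pow_le_pow_right₀ (by linarith) (by omega)
    have hk2 : (1 + w) ^ (s₂.ncard - 1) ≤ (1 + w) ^ k :=
      pow_le_pow_right₀ (by linarith) (by omega)
    rw [hc, show s₁.ncard + s₂.ncard - 1 = k + 1 by omega, pow_succ,
      Set.indicator_union_of_disjoint hd, Set.indicator_union_of_disjoint hd]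
    simp only [Finset.sum_add_distrib]
    set S₁ := ∑ i, s₁.indicator t i
    set S₂ := ∑ i, s₂.indicator t i
    have hA₁ : |S₁| ≤ ∑ i, s₁.indicator (fun i => |t i|) i :=
      (Finset.abs_sum_le_sum_abs _ _).trans (Finset.sum_le_sum fun i _ => by
        simp only [Set.indicator_apply]; split_ifs <;> simp)
    have hA₂ : |S₂| ≤ ∑ i, s₂.indicator (fun i => |t i|) i :=
      (Finset.abs_sum_le_sum_abs _ _).trans (Finset.sum_le_sum fun i _ => by
        simp only [Set.indicator_apply]; split_ifs <;> simp)
    set A₁ := ∑ i, s₁.indicator (fun i => |t i|) i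
    set A₂ := ∑ i, s₂.indicator (fun i => |t i|) i
    have q₁ : 0 ≤ A₁ := (abs_nonneg _).trans hA₁
    have q₂ : 0 ≤ A₂ := (abs_nonneg _).trans hA₂
    have e₁ : |y₁ - S₁| ≤ ((1 + w) ^ k - 1) * A₁ := ih₁.trans (by gcongr)
    have e₂ : |y₂ - S₂| ≤ ((1 + w) ^ k - 1) * A₂ := ih₂.trans (by gcongr)
    have hr := hr.abs_sub_le
    have hy : |y₁ + y₂| ≤ (1 + w) ^ k * (A₁ + A₂) := by
      have : |y₁ + y₂| ≤ |y₁ - S₁| + |y₂ - S₂| + |S₁| + |S₂| := by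
        rw [show y₁ + y₂ = (y₁ - S₁) + (y₂ - S₂) + S₁ + S₂ by ring]
        have a1 := abs_add_le ((y₁ - S₁) + (y₂ - S₂) + S₁) S₂
        have a2 := abs_add_le ((y₁ - S₁) + (y₂ - S₂)) S₁
        have a3 := abs_add_le (y₁ - S₁) (y₂ - S₂)
        linarith
      linarith
    have : |y - (S₁ + S₂)| ≤ |y - (y₁ + y₂)| + |y₁ - S₁| + |y₂ - S₂| := by
      rw [show y - (S₁ + S₂) = (y - (y₁ + y₂)) + (y₁ - S₁) + (y₂ - S₂) by ring]
      have a2 := abs_add_le ((y - (y₁ + y₂)) + (y₁ - S₁)) (y₂ - S₂)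
      have a3 := abs_add_le (y - (y₁ + y₂)) (y₁ - S₁)
      linarith
    have := mul_le_mul_of_nonneg_left hy hw
    linarith

/-- Rounding the products adds one factor `1 + w` to the `n - 1` factors of the summation. -/
theorem FlMulVec.abs_sub_le {w : ℝ} (hw : 0 ≤ w) {A : Matrix ι κ ℝ} {x : κ → ℝ} {y : ι → ℝ}
    (h : FlMulVec w A x y) (i : ι) :
    |y i - ∑ j, A i j * x j| ≤ ((1 + w) ^ Fintype.card κ - 1) * ∑ j, |A i j| * |x j| := by
  obtain ⟨t, ht, hs⟩ := h i
  have h1 := hs.abs_sub_le hw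
  simp only [Set.indicator_univ, Set.ncard_univ, Nat.card_eq_fintype_card] at h1
  rcases isEmpty_or_nonempty κ with hκ | hκ
  · simpa using h1
  have hpos := Fintype.card_pos (α := κ)
  obtain ⟨k, hk⟩ : ∃ k, Fintype.card κ = k + 1 := ⟨_, (Nat.succ_pred_eq_of_pos hpos).symm⟩
  rw [hk] at h1 ⊢
  rw [Nat.add_sub_cancel] at h1
  have ht' : ∀ j, |t j - A i j * x j| ≤ w * (|A i j| * |x j|) := fun j => by
    rw [← abs_mul]; exact (ht j).abs_sub_le
  have h2 : |∑ j, t j - ∑ j, A i j * x j| ≤ w * ∑ j, |A i j| * |x j| := by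
    rw [← Finset.sum_sub_distrib, Finset.mul_sum]
    exact (Finset.abs_sum_le_sum_abs _ _).trans (Finset.sum_le_sum fun j _ => ht' j)
  have h3 : ∑ j, |t j| ≤ (1 + w) * ∑ j, |A i j| * |x j| := by
    rw [Finset.mul_sum]
    refine Finset.sum_le_sum fun j _ => ?_
    have := abs_add_le (t j - A i j * x j) (A i j * x j)
    rw [sub_add_cancel, abs_mul (A i j)] at this
    linarith [ht' j]
  have h4 := mul_le_mul_of_nonneg_left h3 (sub_nonneg.2 (one_le_one_add_pow hw k))
  have h5 := _root_.abs_sub_le (y i) (∑ j, t j) (∑ j, A i j * x j)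
  rw [pow_succ]
  linarith

/-- Product with a matrix whose entries were rounded beforehand. -/
theorem FlMulVec.abs_sub_le_of_rounded {w q : ℝ} (hw : 0 ≤ w)
    {A B : Matrix ι κ ℝ} {x : κ → ℝ} {y : ι → ℝ} (hAB : ∀ i j, Rounded q (A i j) (B i j))
    (h : FlMulVec w B x y) (i : ι) :
    |y i - ∑ j, A i j * x j| ≤
      ((1 + q) * (1 + w) ^ Fintype.card κ - 1) * ∑ j, |A i j| * |x j| := by
  have h1 := h.abs_sub_le hw i
  have hB : ∀ j, |B i j - A i j| ≤ q * |A i j| := fun j => (hAB i j).abs_sub_le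
  have h2 : |∑ j, B i j * x j - ∑ j, A i j * x j| ≤ q * ∑ j, |A i j| * |x j| := by
    rw [← Finset.sum_sub_distrib, Finset.mul_sum]
    refine (Finset.abs_sum_le_sum_abs _ _).trans (Finset.sum_le_sum fun j _ => ?_)
    rw [← sub_mul, abs_mul, ← mul_assoc]
    gcongr
    exact hB j
  have h3 : ∑ j, |B i j| * |x j| ≤ (1 + q) * ∑ j, |A i j| * |x j| := by
    rw [Finset.mul_sum]
    refine Finset.sum_le_sum fun j _ => ?_
    rw [← mul_assoc]
    gcongr
    have := abs_add_le (B i j - A i j) (A i j)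
    rw [sub_add_cancel] at this
    linarith [hB j]
  have h4 := mul_le_mul_of_nonneg_left h3
    (sub_nonneg.2 (one_le_one_add_pow hw (Fintype.card κ)))
  have h5 := _root_.abs_sub_le (y i) (∑ j, B i j * x j) (∑ j, A i j * x j)
  linarith

end Rounding

/-! ## Nearly orthonormal columns -/

section NearlyOrthonormal

variable {m n ι : Type*} [Fintype m] [Fintype n] [Fintype ι] [DecidableEq ι]
  {U : Matrix m ι ℝ} {t : ℝ}

/-- The difference is the quadratic form of the Gram defect `Uᵀ U - 1` at `z`. -/
theorem abs_vecNorm_sq_mulVec_sub_le (h : ‖Uᵀ * U - 1‖ ≤ t) (z : ι → ℝ) :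
    |vecNorm (U *ᵥ z) ^ 2 - vecNorm z ^ 2| ≤ t * vecNorm z ^ 2 := by
  have h1 : vecNorm (U *ᵥ z) ^ 2 - vecNorm z ^ 2 = z ⬝ᵥ ((Uᵀ * U - 1) *ᵥ z) := by
    rw [vecNorm_sq_eq_dotProduct, vecNorm_sq_eq_dotProduct, Matrix.sub_mulVec, Matrix.one_mulVec,
      dotProduct_sub, ← Matrix.mulVec_mulVec, Matrix.dotProduct_mulVec z, Matrix.vecMul_transpose]
  have h2 : |z ⬝ᵥ ((Uᵀ * U - 1) *ᵥ z)| ≤ vecNorm z * vecNorm ((Uᵀ * U - 1) *ᵥ z) := by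
    refine (Finset.abs_sum_le_sum_abs _ _).trans ?_
    simpa only [abs_mul] using sum_abs_mul_abs_le_vecNorm z ((Uᵀ * U - 1) *ᵥ z)
  rw [h1]
  refine h2.trans ?_
  have h3 := (vecNorm_mulVec_le (Uᵀ * U - 1) z).trans
    (mul_le_mul_of_nonneg_right h (vecNorm_nonneg z))
  nlinarith [vecNorm_nonneg z]

theorem vecNorm_mulVec_le_of_gram (h : ‖Uᵀ * U - 1‖ ≤ t) (z : ι → ℝ) :
    vecNorm (U *ᵥ z) ≤ (1 + t) * vecNorm z := by
  have ht : 0 ≤ t := (norm_nonneg _).trans h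
  have h1 := (abs_le.1 (abs_vecNorm_sq_mulVec_sub_le h z)).2
  refine le_of_sq_le_sq ?_ (mul_nonneg (by linarith) (vecNorm_nonneg z))
  nlinarith [mul_nonneg ht (sq_nonneg (vecNorm z)),
    mul_nonneg (sq_nonneg t) (sq_nonneg (vecNorm z))]

theorem le_vecNorm_mulVec_of_gram (h : ‖Uᵀ * U - 1‖ ≤ t) (ht1 : t ≤ 1) (z : ι → ℝ) :
    (1 - t) * vecNorm z ≤ vecNorm (U *ᵥ z) := by
  have ht : 0 ≤ t := (norm_nonneg _).trans h
  have h1 := (abs_le.1 (abs_vecNorm_sq_mulVec_sub_le h z)).1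
  refine le_of_sq_le_sq ?_ (vecNorm_nonneg _)
  nlinarith [mul_nonneg (mul_nonneg ht (sub_nonneg.2 ht1)) (sq_nonneg (vecNorm z))]

theorem vecNorm_single_one (k : ι) : vecNorm (Pi.single k (1 : ℝ)) = 1 := by
  simp [vecNorm]

theorem vecNorm_col_le_of_gram (h : ‖Uᵀ * U - 1‖ ≤ t) (k : ι) :
    vecNorm (fun i => U i k) ≤ 1 + t := by
  have := vecNorm_mulVec_le_of_gram h (Pi.single k 1)
  rw [vecNorm_single_one, mul_one, Matrix.mulVec_single_one] at this
  exact this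

theorem le_vecNorm_col_of_gram (h : ‖Uᵀ * U - 1‖ ≤ t) (ht1 : t ≤ 1) (k : ι) :
    1 - t ≤ vecNorm (fun i => U i k) := by
  have := le_vecNorm_mulVec_of_gram h ht1 (Pi.single k 1)
  rw [vecNorm_single_one, mul_one, Matrix.mulVec_single_one] at this
  exact this

/-- Duality: `‖Uᵀ x‖² = ⟨x, U Uᵀ x⟩`, and one factor `‖Uᵀ x‖` cancels. -/
theorem vecNorm_transpose_mulVec_le_of_gram (h : ‖Uᵀ * U - 1‖ ≤ t) (x : m → ℝ) :
    vecNorm (Uᵀ *ᵥ x) ≤ (1 + t) * vecNorm x := by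
  have h1 : vecNorm (Uᵀ *ᵥ x) ^ 2 ≤ vecNorm (Uᵀ *ᵥ x) * ((1 + t) * vecNorm x) := by
    calc vecNorm (Uᵀ *ᵥ x) ^ 2 = x ⬝ᵥ (U *ᵥ (Uᵀ *ᵥ x)) := by
          rw [vecNorm_sq_eq_dotProduct, Matrix.dotProduct_mulVec x, Matrix.mulVec_transpose]
      _ ≤ vecNorm x * vecNorm (U *ᵥ (Uᵀ *ᵥ x)) := sum_mul_le_vecNorm _ _
      _ ≤ vecNorm x * ((1 + t) * vecNorm (Uᵀ *ᵥ x)) :=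
          mul_le_mul_of_nonneg_left (vecNorm_mulVec_le_of_gram h _) (vecNorm_nonneg x)
      _ = _ := by ring
  rcases (vecNorm_nonneg (Uᵀ *ᵥ x)).eq_or_lt with h0 | h0
  · rw [← h0]
    exact mul_nonneg (by linarith [(norm_nonneg _).trans h]) (vecNorm_nonneg x)
  · rw [sq] at h1
    exact le_of_mul_le_mul_left h1 h0

/-- `U` is injective. For a block this bounds the rank by `|I|`, so that the length of the sums in
the second product is controlled by `N` rather than by `p`. -/
theorem card_le_card_of_gram (h : ‖Uᵀ * U - 1‖ ≤ t) (ht1 : t < 1) :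
    Fintype.card ι ≤ Fintype.card m := by
  have hinj : Function.Injective U.mulVecLin := by
    rw [← LinearMap.ker_eq_bot, LinearMap.ker_eq_bot']
    intro z hz
    have h1 := le_vecNorm_mulVec_of_gram h ht1.le z
    rw [Matrix.mulVecLin_apply] at hz
    have h2 : vecNorm (0 : m → ℝ) = 0 := by simp [vecNorm]
    rw [hz, h2] at h1
    have h3 : vecNorm z = 0 := by
      refine le_antisymm ?_ (vecNorm_nonneg z)
      by_contra hlt
      exact absurd h1 (not_le.2 (mul_pos (by linarith) (not_le.1 hlt)))
    simpa [vecNorm] using h3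
  simpa using LinearMap.finrank_le_finrank_of_injective hinj

/-- Together with `le_frobenius_norm_mul_diagonal_of_gram` this bounds `‖σ‖` by the norm of the
block `U Vᵀ`. -/
theorem le_frobenius_norm_mul_transpose_of_gram (h : ‖Uᵀ * U - 1‖ ≤ t) (ht1 : t ≤ 1)
    (V : Matrix n ι ℝ) : (1 - t) * ‖V‖ ≤ ‖U * Vᵀ‖ := by
  refine le_of_sq_le_sq ?_ (norm_nonneg _)
  rw [mul_pow, frobenius_norm_sq_rows V, frobenius_norm_sq_cols (U * Vᵀ), Finset.mul_sum]
  refine Finset.sum_le_sum fun j _ => ?_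
  rw [← mul_pow]
  exact pow_le_pow_left₀ (mul_nonneg (by linarith) (vecNorm_nonneg _))
    (le_vecNorm_mulVec_of_gram h ht1 (V j)) 2

theorem le_frobenius_norm_mul_diagonal_of_gram (h : ‖Uᵀ * U - 1‖ ≤ t) (ht1 : t ≤ 1)
    (σ : ι → ℝ) : (1 - t) * vecNorm σ ≤ ‖U * Matrix.diagonal σ‖ := by
  refine le_of_sq_le_sq ?_ (norm_nonneg _)
  rw [mul_pow, vecNorm_sq, frobenius_norm_sq_cols, Finset.mul_sum]
  refine Finset.sum_le_sum fun k _ => ?_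
  have h1 : vecNorm (fun i => (U * Matrix.diagonal σ) i k) =
      |σ k| * vecNorm (fun i => U i k) := by
    rw [← vecNorm_smul]
    congr 1
    funext i
    rw [Matrix.mul_diagonal, mul_comm]
  rw [h1, mul_pow, sq_abs, mul_comm]
  gcongr
  exact le_vecNorm_col_of_gram h ht1 k

end NearlyOrthonormal

/-! ## Errors of the products with single blocks -/

section BlockProducts

variable {m n ι : Type*} [Fintype m] [Fintype n] [Fintype ι] [DecidableEq ι]

theorem one_le_rounding_factor {q w : ℝ} (hq : 0 ≤ q) (hw : 0 ≤ w) (k : ℕ) :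
    1 ≤ (1 + q) * (1 + w) ^ k :=
  one_le_mul_of_one_le_of_one_le (by linarith) (one_le_one_add_pow hw k)

theorem FlMulVec.vecNorm_sub_le {q w : ℝ} (hq : 0 ≤ q) (hw : 0 ≤ w) {D D' : Matrix m n ℝ}
    {x : n → ℝ} {y : m → ℝ} (hD : ∀ i j, Rounded q (D i j) (D' i j)) (h : FlMulVec w D' x y) :
    vecNorm (y - D *ᵥ x) ≤ ((1 + q) * (1 + w) ^ Fintype.card n - 1) * (‖D‖ * vecNorm x) := by
  have hα := sub_nonneg.2 (one_le_rounding_factor hq hw (Fintype.card n))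
  refine (vecNorm_mono (w := fun i =>
    ((1 + q) * (1 + w) ^ Fintype.card n - 1) * ∑ j, |D i j| * |x j|) fun i => ?_).trans ?_
  · exact (h.abs_sub_le_of_rounded hw hD i).trans (le_abs_self _)
  · rw [vecNorm_smul, abs_of_nonneg hα]
    exact mul_le_mul_of_nonneg_left (vecNorm_abs_mulVec_le D x) hα

/-- The error splits as `U (z - Vᵀ x) + (y - U z)`, with `β` the relative error of the first product
and `α` that of the second. Cauchy–Schwarz against the singular values replaces a bound on `∑ |z k|`
that would cost a factor `√r`; only the part of `z` that is itself an error pays it. -/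
theorem vecNorm_lowRank_sub_le {q w t : ℝ} (hq : 0 ≤ q) (hw : 0 ≤ w)
    {U U' : Matrix m ι ℝ} {V V' W : Matrix n ι ℝ} {σ : ι → ℝ} {x : n → ℝ} {z : ι → ℝ} {y : m → ℝ}
    (hU : ‖Uᵀ * U - 1‖ ≤ t) (hW : ‖Wᵀ * W - 1‖ ≤ t) (hV : V = W * Matrix.diagonal σ)
    (hU' : ∀ i k, Rounded q (U i k) (U' i k)) (hV' : ∀ j k, Rounded q (V j k) (V' j k))
    (hz : FlMulVec w V'ᵀ x z) (hy : FlMulVec w U' z y) {α β : ℝ}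
    (hα : α = (1 + q) * (1 + w) ^ Fintype.card ι - 1)
    (hβ : β = (1 + q) * (1 + w) ^ Fintype.card n - 1) :
    vecNorm (y - (U * Vᵀ) *ᵥ x) ≤
      (1 + t) ^ 2 * (α + β + α * (β * √(Fintype.card ι : ℝ))) * (vecNorm σ * vecNorm x) := by
  have ht : 0 ≤ t := (norm_nonneg _).trans hU
  have hα0 : 0 ≤ α := hα ▸ sub_nonneg.2 (one_le_rounding_factor hq hw _)
  have hβ0 : 0 ≤ β := hβ ▸ sub_nonneg.2 (one_le_rounding_factor hq hw _)
  have hx := vecNorm_nonneg x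
  have hσ := vecNorm_nonneg σ
  set z₀ := Vᵀ *ᵥ x with hz₀
  have hVe : ∀ j k, V j k = σ k * W j k := fun j k => by
    rw [hV, Matrix.mul_diagonal, mul_comm]
  -- Column `k` of `V` is `σ k` times a nearly unit vector, so the errors decay with the singular
  -- values.
  have hd : ∀ k, |z k - z₀ k| ≤ β * (1 + t) * vecNorm x * |σ k| := fun k => by
    refine (hz.abs_sub_le_of_rounded (A := Vᵀ) hw (fun i j => hV' j i) k).trans ?_
    rw [← hβ]
    have h1 : ∑ j, |Vᵀ k j| * |x j| ≤ (|σ k| * vecNorm fun j => W j k) * vecNorm x := by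
      rw [← vecNorm_smul]
      simpa only [Matrix.transpose_apply, hVe] using
        sum_abs_mul_abs_le_vecNorm (fun j => V j k) x
    have h2 : (|σ k| * vecNorm fun j => W j k) * vecNorm x ≤ (|σ k| * (1 + t)) * vecNorm x := by
      gcongr
      exact vecNorm_col_le_of_gram hW k
    calc _ ≤ β * ((|σ k| * (1 + t)) * vecNorm x) :=
          mul_le_mul_of_nonneg_left (h1.trans h2) hβ0
      _ = _ := by ring
  have hc : 0 ≤ β * (1 + t) * vecNorm x := by positivity
  have hdn : vecNorm (z - z₀) ≤ β * (1 + t) * vecNorm x * vecNorm σ := by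
    rw [← abs_of_nonneg hc, ← vecNorm_smul]
    exact vecNorm_mono fun k => by
      rw [abs_mul, abs_of_nonneg hc]
      exact hd k
  have hd1 : ∑ k, |z k - z₀ k| ≤
      β * (1 + t) * vecNorm x * (√(Fintype.card ι : ℝ) * vecNorm σ) := by
    refine (Finset.sum_le_sum fun k _ => hd k).trans ?_
    rw [← Finset.mul_sum]
    exact mul_le_mul_of_nonneg_left (sum_abs_le_sqrt_card_mul_vecNorm σ) hc
  have hz1 : ∑ k, |z₀ k| ≤ vecNorm σ * ((1 + t) * vecNorm x) := by
    have h1 : ∀ k, |z₀ k| = |σ k| * |(Wᵀ *ᵥ x) k| := fun k => by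
      rw [← abs_mul]
      congr 1
      simp only [hz₀, Matrix.mulVec, dotProduct, Matrix.transpose_apply, hVe, Finset.mul_sum]
      exact Finset.sum_congr rfl fun j _ => by ring
    simp_rw [h1]
    exact (sum_abs_mul_abs_le_vecNorm _ _).trans
      (mul_le_mul_of_nonneg_left (vecNorm_transpose_mulVec_le_of_gram hW x) hσ)
  have hz2 : ∑ k, |z k| ≤ vecNorm σ * ((1 + t) * vecNorm x) +
      β * (1 + t) * vecNorm x * (√(Fintype.card ι : ℝ) * vecNorm σ) := by
    refine le_trans ?_ (add_le_add hz1 hd1)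
    rw [← Finset.sum_add_distrib]
    exact Finset.sum_le_sum fun k _ => by
      simpa using abs_add_le (z₀ k) (z k - z₀ k)
  have he : vecNorm (y - U *ᵥ z) ≤ α * ((1 + t) * ∑ k, |z k|) := by
    refine (vecNorm_mono (w := fun i => α * ∑ k, |z k| * |U i k|) fun i => ?_).trans ?_
    · refine (hy.abs_sub_le_of_rounded hw hU' i).trans ?_
      rw [← hα]
      simp_rw [mul_comm |z _|]
      exact le_abs_self _
    · rw [vecNorm_smul, abs_of_nonneg hα0]
      refine mul_le_mul_of_nonneg_left ((vecNorm_sum_le _ fun k i => |z k| * |U i k|).trans ?_) hα0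
      rw [Finset.mul_sum]
      refine Finset.sum_le_sum fun k _ => ?_
      rw [vecNorm_smul, abs_abs, vecNorm_abs (fun i => U i k), mul_comm]
      gcongr
      exact vecNorm_col_le_of_gram hU k
  have hsplit : y - (U * Vᵀ) *ᵥ x = U *ᵥ (z - z₀) + (y - U *ᵥ z) := by
    rw [Matrix.mulVec_sub, hz₀, Matrix.mulVec_mulVec]
    abel
  have h1 := vecNorm_add_le (U *ᵥ (z - z₀)) (y - U *ᵥ z)
  rw [← hsplit] at h1
  have h2 := (vecNorm_mulVec_le_of_gram hU (z - z₀)).trans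
    (mul_le_mul_of_nonneg_left hdn (by linarith))
  have h3 := he.trans (mul_le_mul_of_nonneg_left
    (mul_le_mul_of_nonneg_left hz2 (by linarith : 0 ≤ 1 + t)) hα0)
  calc _ ≤ _ := h1.trans (add_le_add h2 h3)
    _ = _ := by ring

theorem rounding_factor_sub_one_le {q w τ : ℝ} {k : ℕ} (hq : 0 ≤ q) (hw : 0 ≤ w)
    (hk : k * w ≤ τ) (hτ : τ ≤ 1 / 1000) (hq1 : q ≤ 1 / 1000) :
    (1 + q) * (1 + w) ^ k - 1 ≤ q + 1.003 * τ := by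
  have hτ0 : 0 ≤ τ := le_trans (by positivity) hk
  have h1 := one_add_pow_sub_one_le hw hk (by linarith)
  have h2 : (1 + w) ^ k - 1 ≤ 1.001 * τ := by nlinarith
  have h3 := mul_le_mul_of_nonneg_left h2 (by linarith : 0 ≤ 1 + q)
  nlinarith

/-- Computed product with a compressed block. -/
theorem vecNorm_lowRank_sub_le_of_small {q w t ε : ℝ} (hq : 0 ≤ q) (hw : 0 ≤ w)
    {U U' : Matrix m ι ℝ} {V V' W : Matrix n ι ℝ} {σ : ι → ℝ} {x : n → ℝ} {z : ι → ℝ} {y : m → ℝ}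
    (hU : ‖Uᵀ * U - 1‖ ≤ t) (hW : ‖Wᵀ * W - 1‖ ≤ t) (hV : V = W * Matrix.diagonal σ)
    (hU' : ∀ i k, Rounded q (U i k) (U' i k)) (hV' : ∀ j k, Rounded q (V j k) (V' j k))
    (hz : FlMulVec w V'ᵀ x z) (hy : FlMulVec w U' z y)
    (ht : t ≤ 1 / 1000) (hε : ε ≤ 1 / 1000) (hq1 : q ≤ 1 / 1000)
    (hrε : √(Fintype.card ι : ℝ) * ε ≤ 1 / 1000) (hrq : √(Fintype.card ι : ℝ) * q ≤ 1 / 1000)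
    (hcard : (Fintype.card n + Fintype.card m : ℕ) * w ≤ ε) :
    vecNorm (y - (U * Vᵀ) *ᵥ x) ≤ 1.011 * ((2 * q + ε) * (‖U * Vᵀ‖ * vecNorm x)) := by
  have ht0 : 0 ≤ t := (norm_nonneg _).trans hU
  have hmain := vecNorm_lowRank_sub_le hq hw hU hW hV hU' hV' hz hy rfl rfl
  set α := (1 + q) * (1 + w) ^ Fintype.card ι - 1 with hα
  set β := (1 + q) * (1 + w) ^ Fintype.card n - 1 with hβ
  have hα0 : 0 ≤ α := sub_nonneg.2 (one_le_rounding_factor hq hw _)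
  have hβ0 : 0 ≤ β := sub_nonneg.2 (one_le_rounding_factor hq hw _)
  -- The sums of both products together have length at most `|J| + |I|`, so their rounding costs one
  -- `ε`, not two.
  have hr : (Fintype.card ι : ℝ) ≤ Fintype.card m := by
    exact_mod_cast card_le_card_of_gram hU (by linarith)
  have hn0 : (0 : ℝ) ≤ Fintype.card n * w := by positivity
  have hr0 : (0 : ℝ) ≤ Fintype.card ι * w := by positivity
  have hsum : (Fintype.card n : ℝ) * w + Fintype.card ι * w ≤ ε := by
    push_cast at hcard
    have := mul_le_mul_of_nonneg_right hr hw
    linarith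
  have hα1 : α ≤ q + 1.003 * (Fintype.card ι * w) :=
    rounding_factor_sub_one_le hq hw le_rfl (by linarith) hq1
  have hβ1 : β ≤ q + 1.003 * (Fintype.card n * w) :=
    rounding_factor_sub_one_le hq hw le_rfl (by linarith) hq1
  have hβr : β * √(Fintype.card ι : ℝ) ≤ 0.0021 := by
    have h1 : β ≤ q + 1.003 * ε := by linarith
    have h2 := mul_le_mul_of_nonneg_right h1 (Real.sqrt_nonneg (Fintype.card ι : ℝ))
    linarith
  have hsecond : α * (β * √(Fintype.card ι : ℝ)) ≤ α * 0.0021 :=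
    mul_le_mul_of_nonneg_left hβr hα0
  have hε0 : 0 ≤ ε := by linarith
  have htot : α + β + α * (β * √(Fintype.card ι : ℝ)) ≤ 1.0052 * (2 * q + ε) := by linarith
  have htot0 : 0 ≤ α + β + α * (β * √(Fintype.card ι : ℝ)) := by positivity
  -- Each factor of the block loses at most `1 - t ≥ 0.999`, and `0.999² ≥ 0.998`.
  have hσ : 0.998 * vecNorm σ ≤ ‖U * Vᵀ‖ := by
    have h1 := le_frobenius_norm_mul_transpose_of_gram hU (by linarith) V
    have h2 := le_frobenius_norm_mul_diagonal_of_gram hW (by linarith) σ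
    rw [← hV] at h2
    have h3 : (1 - t) * ((1 - t) * vecNorm σ) ≤ ‖U * Vᵀ‖ :=
      (mul_le_mul_of_nonneg_left h2 (by linarith)).trans h1
    have hσ0 := vecNorm_nonneg σ
    have h4 : 0.999 * (0.999 * vecNorm σ) ≤ (1 - t) * ((1 - t) * vecNorm σ) := by
      gcongr <;> linarith
    linarith
  have ht2 : (1 + t) ^ 2 ≤ 1.0021 :=
    (pow_le_pow_left₀ (by linarith) (by linarith : 1 + t ≤ 1.001) 2).trans (by norm_num)
  have hx := vecNorm_nonneg x
  calc _ ≤ _ := hmain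
    _ ≤ 1.0021 * (1.0052 * (2 * q + ε)) * (‖U * Vᵀ‖ / 0.998 * vecNorm x) := by
        gcongr
        · exact mul_nonneg (vecNorm_nonneg σ) hx
        · rw [le_div_iff₀ (by norm_num)]
          linarith
    _ = 1.0021 * 1.0052 / 0.998 * ((2 * q + ε) * (‖U * Vᵀ‖ * vecNorm x)) := by ring
    _ ≤ _ := mul_le_mul_of_nonneg_right (by norm_num) (by positivity)

end BlockProducts

/-! ## Geometry of the hypercubes -/

section Geometry

theorem le_setDist {E : Type*} [PseudoMetricSpace E] {X Y : Set E} {a : ℝ} (hX : X.Nonempty)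
    (hY : Y.Nonempty) (h : ∀ x ∈ X, ∀ y ∈ Y, a ≤ dist x y) : a ≤ setDist X Y := by
  refine le_csInf (hX.image2 hY) ?_
  rintro _ ⟨x, hx, y, hy, rfl⟩
  exact h x hx y hy

theorem setDist_le_dist {E : Type*} [PseudoMetricSpace E] {X Y : Set E} {x y : E} (hx : x ∈ X)
    (hy : y ∈ Y) : setDist X Y ≤ dist x y := by
  refine csInf_le ⟨0, ?_⟩ ⟨x, hx, y, hy, rfl⟩
  rintro _ ⟨x, _, y, _, rfl⟩
  exact dist_nonneg

theorem setDist_comm {E : Type*} [PseudoMetricSpace E] (X Y : Set E) :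
    setDist X Y = setDist Y X := by
  unfold setDist
  rw [Set.image2_swap]
  simp_rw [dist_comm]

namespace Hypercube

variable {d : ℕ} (C : Hypercube d) (l : ℕ)

theorem cell_pos : 0 < C.side / 2 ^ l := div_pos C.side_pos (by positivity)

theorem toLp_mem_box {i : Fin d → ℕ} {a : ℝ} (h0 : 0 ≤ a) (h1 : a ≤ 1) :
    WithLp.toLp 2 (fun k => C.corner k + C.side / 2 ^ l * (i k + a)) ∈ C.box l i := fun k => by
  have := C.cell_pos l
  constructor <;> simp only <;> gcongr
  linarith

theorem box_nonempty (i : Fin d → ℕ) : (C.box l i).Nonempty :=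
  ⟨_, C.toLp_mem_box l le_rfl zero_le_one⟩

theorem dist_le_of_mem_box {i : Fin d → ℕ} {x y : EuclideanSpace ℝ (Fin d)}
    (hx : x ∈ C.box l i) (hy : y ∈ C.box l i) : dist x y ≤ √(d : ℝ) * (C.side / 2 ^ l) := by
  have hs := C.cell_pos l
  rw [EuclideanSpace.dist_eq]
  refine (Real.sqrt_le_left (by positivity)).2 ?_
  rw [mul_pow, Real.sq_sqrt (by positivity)]
  calc _ ≤ ∑ _k : Fin d, (C.side / 2 ^ l) ^ 2 := by
        refine Finset.sum_le_sum fun k _ => pow_le_pow_left₀ dist_nonneg ?_ 2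
        rw [Real.dist_eq, abs_le]
        have := hx k
        have := hy k
        constructor <;> linarith
    _ = _ := by simp

theorem isBounded_box (i : Fin d → ℕ) : Bornology.IsBounded (C.box l i) :=
  Metric.isBounded_iff.2 ⟨_, fun _ hx _ hy => C.dist_le_of_mem_box l hx hy⟩

theorem diam_box_le (i : Fin d → ℕ) :
    Metric.diam (C.box l i) ≤ √(d : ℝ) * (C.side / 2 ^ l) :=
  Metric.diam_le_of_forall_dist_le (mul_nonneg (Real.sqrt_nonneg _) (C.cell_pos l).le)
    fun _ hx _ hy => C.dist_le_of_mem_box l hx hy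

theorem diam_box_pos (hd : 1 ≤ d) (i : Fin d → ℕ) : 0 < Metric.diam (C.box l i) := by
  refine lt_of_lt_of_le ?_ (Metric.dist_le_diam_of_mem (C.isBounded_box l i)
    (C.toLp_mem_box l le_rfl zero_le_one) (C.toLp_mem_box l zero_le_one le_rfl))
  rw [dist_pos]
  intro h
  have h1 := congrArg (fun z : EuclideanSpace ℝ (Fin d) => z ⟨0, hd⟩) h
  have := C.cell_pos l
  simp only [add_zero, add_right_inj] at h1
  nlinarith

theorem box_succ_subset (i : Fin d → ℕ) : C.box (l + 1) i ⊆ C.box l (parentIdx i) := by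
  intro z hz k
  have hs := C.cell_pos (l + 1)
  have h2 : C.side / 2 ^ l = C.side / 2 ^ (l + 1) * 2 := by
    rw [pow_succ]; field_simp
  obtain ⟨h3, h4⟩ := hz k
  have e1 : 2 * (((i k / 2 : ℕ) : ℝ)) ≤ i k := by exact_mod_cast (by omega : 2 * (i k / 2) ≤ i k)
  have e2 : (i k : ℝ) + 1 ≤ 2 * (((i k / 2 : ℕ) : ℝ) + 1) := by
    exact_mod_cast (by omega : i k + 1 ≤ 2 * (i k / 2 + 1))
  simp only [parentIdx, h2]
  constructor
  · refine le_trans ?_ h3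
    rw [mul_assoc]
    gcongr
  · refine h4.trans ?_
    rw [mul_assoc]
    gcongr

theorem le_dist_of_mem_box {i j : Fin d → ℕ} {k : Fin d} {c : ℕ} (hc : i k + c + 1 ≤ j k)
    {x y : EuclideanSpace ℝ (Fin d)} (hx : x ∈ C.box l i) (hy : y ∈ C.box l j) :
    C.side / 2 ^ l * c ≤ dist x y := by
  have hs := C.cell_pos l
  have h1 : dist (x k) (y k) ≤ dist x y := by
    rw [EuclideanSpace.dist_eq]
    exact Real.le_sqrt_of_sq_le (Finset.single_le_sum (f := fun k => dist (x k) (y k) ^ 2)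
      (fun _ _ => sq_nonneg _) (Finset.mem_univ k))
  refine le_trans ?_ h1
  rw [dist_comm, Real.dist_eq]
  refine le_trans ?_ (le_abs_self _)
  have hc' : (i k : ℝ) + 1 + c ≤ j k := by exact_mod_cast (by omega : i k + 1 + c ≤ j k)
  have := mul_le_mul_of_nonneg_left hc' hs.le
  linarith [(hx k).2, (hy k).1]

end Hypercube

namespace ClusterTree

variable {d N L : ℕ} (T : ClusterTree d N L) {η : ℝ} {l : ℕ} {i j : Fin d → ℕ}

theorem AdmS_comm : T.AdmS η l i j ↔ T.AdmS η l j i := by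
  unfold AdmS
  rw [min_comm, setDist_comm]

/-- With side length `s` and `c = ⌈√d / η⌉`, a gap of `c` cells gives `diam ≤ √d s ≤ η c s ≤ η
dist`. -/
theorem AdmS_of_separated (hη : 0 < η) {k : Fin d}
    (h : i k + ⌈√(d : ℝ) / η⌉₊ + 1 ≤ j k) : T.AdmS η l i j := by
  have h1 := le_setDist (T.box_nonempty l i) (T.box_nonempty l j)
    fun x hx y hy => T.le_dist_of_mem_box l h hx hy
  have h2 := Nat.le_ceil (√(d : ℝ) / η)
  rw [div_le_iff₀ hη] at h2
  have hs := T.cell_pos l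
  unfold AdmS
  calc _ ≤ √(d : ℝ) * (T.side / 2 ^ l) := (min_le_left _ _).trans (T.diam_box_le l i)
    _ ≤ ⌈√(d : ℝ) / η⌉₊ * η * (T.side / 2 ^ l) := by gcongr
    _ = η * (T.side / 2 ^ l * ⌈√(d : ℝ) / η⌉₊) := by ring
    _ ≤ _ := by gcongr

theorem near_of_not_AdmS (hη : 0 < η) (h : ¬ T.AdmS η l i j) (k : Fin d) :
    i k - ⌈√(d : ℝ) / η⌉₊ ≤ j k ∧ j k ≤ i k + ⌈√(d : ℝ) / η⌉₊ := by
  constructor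
  · by_contra hlt
    exact h (T.AdmS_comm.2 (T.AdmS_of_separated hη (k := k) (by omega)))
  · by_contra hlt
    exact h (T.AdmS_of_separated hη (k := k) (by omega))

theorem not_AdmS_self (hd : 1 ≤ d) (hη : 0 < η) : ¬ T.AdmS η l i i := by
  unfold AdmS
  rw [min_self, not_le]
  refine lt_of_le_of_lt ?_ (T.diam_box_pos l hd i)
  obtain ⟨x, hx⟩ := T.box_nonempty l i
  have := setDist_le_dist hx hx
  rw [dist_self] at this
  exact mul_nonpos_of_nonneg_of_nonpos hη.le this

/-- Passing to subcubes shrinks diameters and does not decrease the distance. -/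
theorem AdmS.of_parent (hη : 0 < η) (h : T.AdmS η l (parentIdx i) (parentIdx j)) :
    T.AdmS η (l + 1) i j := by
  unfold AdmS at h ⊢
  refine le_trans (min_le_min ?_ ?_) (h.trans ?_)
  · exact Metric.diam_mono (T.box_succ_subset l i) (T.isBounded_box l _)
  · exact Metric.diam_mono (T.box_succ_subset l j) (T.isBounded_box l _)
  · gcongr
    exact le_setDist (T.box_nonempty _ i) (T.box_nonempty _ j) fun x hx y hy =>
      setDist_le_dist (T.box_succ_subset l i hx) (T.box_succ_subset l j hy)

/-! ## Ancestors and the block partition -/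

/-- Grid position of the hypercube of level `l` that contains the particle `n`. -/
def ancestor (l : ℕ) (n : Fin N) : Fin d → ℕ := fun k => T.leaf n k / 2 ^ (L - l)

theorem mem_cluster {n : Fin N} : n ∈ T.cluster l i ↔ T.ancestor l n = i := by
  simp [cluster, ancestor, funext_iff]

theorem mem_rows {B : Block d} {n : Fin N} : n ∈ T.rows B ↔ T.ancestor B.level n = B.row :=
  T.mem_cluster

theorem mem_cols {B : Block d} {n : Fin N} : n ∈ T.cols B ↔ T.ancestor B.level n = B.col :=
  T.mem_cluster

theorem parentIdx_ancestor (h : l + 1 ≤ L) (n : Fin N) :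
    parentIdx (T.ancestor (l + 1) n) = T.ancestor l n := by
  funext k
  simp only [parentIdx, ancestor]
  rw [Nat.div_div_eq_div_mul, ← pow_succ, show L - (l + 1) + 1 = L - l by omega]

theorem isGridIndex_ancestor (h : l ≤ L) (n : Fin N) : IsGridIndex l (T.ancestor l n) := by
  intro k
  simp only [ancestor]
  rw [Nat.div_lt_iff_lt_mul (by positivity), ← pow_add, show l + (L - l) = L by omega]
  exact T.leaf_grid n k

theorem ancestor_zero_eq (r m : Fin N) : T.ancestor 0 r = T.ancestor 0 m := by
  funext k
  have h1 := T.isGridIndex_ancestor (Nat.zero_le L) r k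
  have h2 := T.isGridIndex_ancestor (Nat.zero_le L) m k
  rw [pow_zero] at h1 h2
  omega

end ClusterTree

/-- For a pair of particles, `a l` says that their level-`l` cubes are admissible and `e l` that
these coincide. Descending the tree, `a` persists once true, `e` persists once false, and they
exclude each other. If `a ℓ`, the pair lies in a far block at the first admissible level; if neither
holds at `ℓ`, in a neighbor block; if `e ℓ`, in a sibling block at the first level of separation, or
in a diagonal block if there is none. -/
theorem existsUnique_block_level {a e : ℕ → Prop} {ℓ L : ℕ} (hℓ : ℓ ≤ L)
    (ha : ∀ l, l + 1 ≤ L → a l → a (l + 1)) (he : ∀ l, l + 1 ≤ L → e (l + 1) → e l)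
    (hae : ∀ l, e l → ¬ a l) (he0 : e 0) :
    ∃! l, (1 ≤ l ∧ l ≤ ℓ ∧ a l ∧ ¬ a (l - 1)) ∨ (l = ℓ ∧ ¬ a ℓ ∧ ¬ e ℓ) ∨
      (ℓ + 1 ≤ l ∧ l ≤ L ∧ ¬ e l ∧ e (l - 1)) ∨ (l = L ∧ e L) := by
  classical
  have ha' : ∀ l l', l ≤ l' → l' ≤ L → a l → a l' := fun l l' hl => by
    induction l', hl using Nat.le_induction with
    | base => exact fun _ h => h
    | succ k _ ih => exact fun hk h => ha k hk (ih (by omega) h)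
  have he' : ∀ l l', l ≤ l' → l' ≤ L → e l' → e l := fun l l' hl => by
    induction l', hl using Nat.le_induction with
    | base => exact fun _ h => h
    | succ k _ ih => exact fun hk h => ih (by omega) (he k hk h)
  refine existsUnique_of_exists_of_unique ?_ ?_
  · by_cases h1 : a ℓ
    · have hex : ∃ l, a l := ⟨ℓ, h1⟩
      have hpos : Nat.find hex ≠ 0 := fun h0 => hae 0 he0 (h0 ▸ Nat.find_spec hex)
      exact ⟨Nat.find hex, .inl ⟨by omega, Nat.find_min' hex h1, Nat.find_spec hex,
        Nat.find_min hex (by omega)⟩⟩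
    by_cases h2 : e ℓ
    · by_cases h3 : e L
      · exact ⟨L, by simp [h3]⟩
      have hex : ∃ l, ¬ e l := ⟨L, h3⟩
      have hle : Nat.find hex ≤ L := Nat.find_min' hex h3
      have hlt : ℓ + 1 ≤ Nat.find hex := by
        by_contra hlt
        exact Nat.find_spec hex (he' _ ℓ (by omega) hℓ h2)
      exact ⟨Nat.find hex, .inr (.inr (.inl ⟨hlt, hle, Nat.find_spec hex,
        not_not.1 (Nat.find_min hex (by omega))⟩))⟩
    · exact ⟨ℓ, by simp [h1, h2]⟩
  · have key : ∀ l l', l < l' →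
        ((1 ≤ l ∧ l ≤ ℓ ∧ a l ∧ ¬ a (l - 1)) ∨ (l = ℓ ∧ ¬ a ℓ ∧ ¬ e ℓ) ∨
          (ℓ + 1 ≤ l ∧ l ≤ L ∧ ¬ e l ∧ e (l - 1)) ∨ (l = L ∧ e L)) →
        ((1 ≤ l' ∧ l' ≤ ℓ ∧ a l' ∧ ¬ a (l' - 1)) ∨ (l' = ℓ ∧ ¬ a ℓ ∧ ¬ e ℓ) ∨
          (ℓ + 1 ≤ l' ∧ l' ≤ L ∧ ¬ e l' ∧ e (l' - 1)) ∨ (l' = L ∧ e L)) → False := by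
      rintro l l' hlt (⟨h1, h2, h3, h4⟩ | ⟨rfl, h3, h4⟩ | ⟨h1, h2, h3, h4⟩ | ⟨rfl, h3⟩)
        (⟨k1, k2, k3, k4⟩ | ⟨rfl, k3, k4⟩ | ⟨k1, k2, k3, k4⟩ | ⟨rfl, k3⟩) <;> try omega
      · exact k4 (ha' l (l' - 1) (by omega) (by omega) h3)
      · exact k3 (ha' l _ (by omega) (by omega) h3)
      · exact hae ℓ (he' ℓ (l' - 1) (by omega) (by omega) k4) (ha' l ℓ h2 hℓ h3)
      · exact hae ℓ (he' ℓ _ hℓ le_rfl k3) (ha' l ℓ h2 hℓ h3)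
      · exact h4 (he' _ (l' - 1) (by omega) (by omega) k4)
      · exact h4 (he' _ _ hℓ le_rfl k3)
      · exact h3 (he' _ (l' - 1) (by omega) (by omega) k4)
      · exact h3 (he' _ _ (by omega) le_rfl k3)
    intro l l' h h'
    rcases lt_trichotomy l l' with hlt | heq | hlt
    · exact (key l l' hlt h h').elim
    · exact heq
    · exact (key l' l hlt h' h).elim

namespace ClusterTree

variable {d N L : ℕ} (T : ClusterTree d N L) {η : ℝ} {ℓ : ℕ}

/-- The blocks partition the index pairs of the matrix. -/
theorem existsUnique_isBlock (hd : 1 ≤ d) (hη : 0 < η) (hℓ : ℓ ≤ L) (r m : Fin N) :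
    ∃! B, T.IsBlock η ℓ B ∧ r ∈ T.rows B ∧ m ∈ T.cols B := by
  set a : ℕ → Prop := fun l => T.AdmS η l (T.ancestor l r) (T.ancestor l m)
  set e : ℕ → Prop := fun l => T.ancestor l r = T.ancestor l m
  have hex := existsUnique_block_level (a := a) (e := e) hℓ
    (fun l hl h => by
      refine AdmS.of_parent T hη ?_
      rw [T.parentIdx_ancestor hl, T.parentIdx_ancestor hl]
      exact h)
    (fun l hl h => by
      have := congrArg parentIdx (h : T.ancestor (l + 1) r = _)
      rwa [T.parentIdx_ancestor hl, T.parentIdx_ancestor hl] at this)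
    (fun l h => by
      change ¬ T.AdmS η l (T.ancestor l r) (T.ancestor l m)
      rw [show T.ancestor l r = T.ancestor l m from h]
      exact T.not_AdmS_self hd hη)
    (T.ancestor_zero_eq r m)
  have hiff : ∀ l, T.IsBlock η ℓ ⟨l, T.ancestor l r, T.ancestor l m⟩ ↔
      (1 ≤ l ∧ l ≤ ℓ ∧ a l ∧ ¬ a (l - 1)) ∨ (l = ℓ ∧ ¬ a ℓ ∧ ¬ e ℓ) ∨
      (ℓ + 1 ≤ l ∧ l ≤ L ∧ ¬ e l ∧ e (l - 1)) ∨ (l = L ∧ e L) := by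
    intro l
    have hr : (T.rows ⟨l, T.ancestor l r, T.ancestor l m⟩).Nonempty := ⟨r, T.mem_rows.2 rfl⟩
    have hc : (T.cols ⟨l, T.ancestor l r, T.ancestor l m⟩).Nonempty := ⟨m, T.mem_cols.2 rfl⟩
    have hpar : ∀ n, 1 ≤ l → l ≤ L → parentIdx (T.ancestor l n) = T.ancestor (l - 1) n := by
      intro n h1 h2
      obtain ⟨l, rfl⟩ := Nat.exists_eq_add_of_le' h1
      exact T.parentIdx_ancestor h2 n
    simp only [IsBlock, IsAdmissible, IsDiagonal, IsFar, IsNeighbor, Block.IsAdjacent, ILs, Ns,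
      weakIL, Set.mem_ofPred_eq, hr, hc, and_true]
    rw [or_assoc, or_assoc]
    refine or_congr ?_ (or_congr ?_ (or_congr ?_ ?_))
    · refine and_congr_right fun h1 => and_congr_right fun h2 => ?_
      have hl : l ≤ L := h2.trans hℓ
      rw [hpar _ h1 hl, hpar _ h1 hl]
      exact ⟨fun h => h.2.2, fun h => ⟨T.isGridIndex_ancestor hl r, T.isGridIndex_ancestor hl m, h⟩⟩
    · refine and_congr_right fun h1 => ?_
      subst h1
      exact ⟨fun h => ⟨h.2.2.1, fun h' => h.2.2.2 h'.symm⟩, fun h =>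
        ⟨T.isGridIndex_ancestor hℓ r, T.isGridIndex_ancestor hℓ m, h.1, fun h' => h.2 h'.symm⟩⟩
    · refine and_congr_right fun h1 => and_congr_right fun hl => ?_
      rw [hpar _ (by omega) hl, hpar _ (by omega) hl]
      exact ⟨fun h => ⟨fun h' => h.2.2.1 h'.symm, h.2.2.2.symm⟩, fun h =>
        ⟨T.isGridIndex_ancestor hl r, T.isGridIndex_ancestor hl m, fun h' => h.1 h'.symm,
          h.2.symm⟩⟩
    · refine and_congr_right fun h1 => ?_
      subst h1
      exact ⟨fun h => h.2.symm, fun h => ⟨T.isGridIndex_ancestor le_rfl r, h.symm⟩⟩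
  obtain ⟨l, hl, huniq⟩ := hex
  refine ⟨⟨l, T.ancestor l r, T.ancestor l m⟩,
    ⟨(hiff l).2 hl, T.mem_rows.2 rfl, T.mem_cols.2 rfl⟩, ?_⟩
  rintro ⟨l', i, j⟩ ⟨hB, hr, hm⟩
  obtain rfl : T.ancestor l' r = i := T.mem_rows.1 hr
  obtain rfl : T.ancestor l' m = j := T.mem_cols.1 hm
  obtain rfl := huniq l' ((hiff l').1 hB)
  rfl

theorem IsAdmissible.col_ne_row (hd : 1 ≤ d) (hη : 0 < η) {B : Block d}
    (h : T.IsAdmissible η ℓ B) : B.col ≠ B.row := by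
  rcases h.1 with h | h | h
  · intro he
    have := h.2.2.2.2.1
    rw [he] at this
    exact T.not_AdmS_self hd hη this
  · exact h.2.2.2.2
  · exact h.2.2.2.2.1

/-- Distinct cubes of one level have disjoint clusters. -/
theorem card_cols_add_card_rows_le (hd : 1 ≤ d) (hη : 0 < η) {B : Block d}
    (h : T.IsAdmissible η ℓ B) : (T.cols B).card + (T.rows B).card ≤ N := by
  have hdis : Disjoint (T.cols B) (T.rows B) := by
    rw [Finset.disjoint_left]
    intro n h1 h2
    exact IsAdmissible.col_ne_row T hd hη h ((T.mem_cols.1 h1).symm.trans (T.mem_rows.1 h2))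
  rw [← Finset.card_union_of_disjoint hdis]
  simpa using Finset.card_le_univ (T.cols B ∪ T.rows B)

end ClusterTree

end Geometry

/-! ## Counting the admissible blocks -/

section Counting

variable {d : ℕ}

/-- There are `2^(dl)` possible rows, and `f`, `g` confine each coordinate of the column to a window
of at most `n` values; the weight cancels the number of rows. -/
theorem sum_inv_two_pow_level_le {S : Finset (Block d)} {l n : ℕ} (f g : (Fin d → ℕ) → Fin d → ℕ)
    (h : ∀ B ∈ S, B.level = l ∧ IsGridIndex l B.row ∧
      ∀ k, f B.row k ≤ B.col k ∧ B.col k ≤ g B.row k)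
    (hn : ∀ i k, g i k + 1 - f i k ≤ n) :
    ∑ B ∈ S, ((2 : ℝ) ^ (d * B.level))⁻¹ ≤ (n : ℝ) ^ d := by
  have hcard : S.card ≤ 2 ^ (d * l) * n ^ d := by
    calc S.card ≤ ((Fintype.piFinset fun _ : Fin d => Finset.range (2 ^ l)).sigma
          fun i => Fintype.piFinset fun k => Finset.Icc (f i k) (g i k)).card := by
          refine Finset.card_le_card_of_injOn (fun B => ⟨B.row, B.col⟩) ?_ ?_
          · intro B hB
            simp only [Finset.coe_sigma, Set.mem_sigma_iff, Finset.mem_coe, Fintype.mem_piFinset,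
              Finset.mem_range, Finset.mem_Icc]
            exact (h B hB).2
          · rintro ⟨l₁, i₁, j₁⟩ h₁ ⟨l₂, i₂, j₂⟩ h₂ heq
            obtain rfl := (h _ h₁).1
            obtain rfl := (h _ h₂).1
            simp only [Sigma.mk.injEq, heq_eq_eq] at heq
            obtain ⟨rfl, rfl⟩ := heq
            rfl
      _ ≤ ∑ i ∈ Fintype.piFinset fun _ : Fin d => Finset.range (2 ^ l), n ^ d := by
          rw [Finset.card_sigma]
          refine Finset.sum_le_sum fun i _ => ?_
          rw [Fintype.card_piFinset]
          calc _ ≤ ∏ _k : Fin d, n := by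
                refine Finset.prod_le_prod' fun k _ => ?_
                rw [Nat.card_Icc]
                exact hn i k
            _ = n ^ d := by simp
      _ = _ := by simp [pow_mul, mul_comm d l]
  calc _ = ∑ B ∈ S, ((2 : ℝ) ^ (d * l))⁻¹ :=
        Finset.sum_congr rfl fun B hB => by rw [(h B hB).1]
    _ = S.card * ((2 : ℝ) ^ (d * l))⁻¹ := by simp
    _ ≤ (2 ^ (d * l) * n ^ d) * ((2 : ℝ) ^ (d * l))⁻¹ := by
        gcongr
        exact_mod_cast hcard
    _ = _ := by field_simp

theorem sum_inv_two_pow_levels_le {S : Finset (Block d)} {A : Finset ℕ} {n : ℕ}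
    (f g : (Fin d → ℕ) → Fin d → ℕ)
    (h : ∀ B ∈ S, B.level ∈ A ∧ IsGridIndex B.level B.row ∧
      ∀ k, f B.row k ≤ B.col k ∧ B.col k ≤ g B.row k)
    (hn : ∀ i k, g i k + 1 - f i k ≤ n) :
    ∑ B ∈ S, ((2 : ℝ) ^ (d * B.level))⁻¹ ≤ A.card * (n : ℝ) ^ d := by
  classical
  rw [← Finset.sum_fiberwise_of_maps_to (g := Block.level) (t := A) fun B hB => (h B hB).1,
    ← nsmul_eq_mul]
  refine Finset.sum_le_card_nsmul _ _ _ fun l _ => ?_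
  refine sum_inv_two_pow_level_le (l := l) f g (fun B hB => ?_) hn
  obtain ⟨hBS, rfl⟩ := Finset.mem_filter.1 hB
  exact ⟨rfl, (h B hBS).2⟩

variable {N L : ℕ} (T : ClusterTree d N L) {η : ℝ} {ℓ : ℕ}

theorem ClusterTree.sum_admissible_le (hη : 0 < η) (hℓ : ℓ ≤ L) {S : Finset (Block d)}
    (hS : ∀ B ∈ S, T.IsAdmissible η ℓ B) :
    ∑ B ∈ S, ((2 : ℝ) ^ (d * B.level))⁻¹ ≤
      ℓ * (2 * (1 + 2 * (⌈√(d : ℝ) / η⌉₊ : ℝ))) ^ d + (1 + 2 * (⌈√(d : ℝ) / η⌉₊ : ℝ)) ^ d +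
        ((L : ℝ) - ℓ) * 2 ^ d := by
  classical
  set c := ⌈√(d : ℝ) / η⌉₊ with hc
  have hfar : ∑ B ∈ S.filter (T.IsFar η ℓ), ((2 : ℝ) ^ (d * B.level))⁻¹ ≤
      (Finset.Icc 1 ℓ).card * ((2 * (1 + 2 * c) : ℕ) : ℝ) ^ d := by
    -- The parents are inadmissible, hence within `c` cells in each coordinate; the window consists
    -- of the children of these `1 + 2c` positions. Truncated subtraction only shortens it.
    refine sum_inv_two_pow_levels_le (fun i k => 2 * (i k / 2 - c))
      (fun i k => 2 * (i k / 2 + c) + 1) (fun B hB => ?_) fun i k => by omega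
    obtain ⟨h1, h2, h3, h4⟩ := (Finset.mem_filter.1 hB).2
    refine ⟨Finset.mem_Icc.2 ⟨h1, h2⟩, h3, fun k => ?_⟩
    have := T.near_of_not_AdmS hη h4.2.2 k
    simp only [parentIdx] at this
    omega
  have hnbr : ∑ B ∈ S.filter (T.IsNeighbor η ℓ), ((2 : ℝ) ^ (d * B.level))⁻¹ ≤
      ({ℓ} : Finset ℕ).card * ((1 + 2 * c : ℕ) : ℝ) ^ d := by
    refine sum_inv_two_pow_levels_le (fun i k => i k - c) (fun i k => i k + c)
      (fun B hB => ?_) fun i k => by omega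
    obtain ⟨h1, h3, h4⟩ := (Finset.mem_filter.1 hB).2
    exact ⟨Finset.mem_singleton.2 h1, h3, T.near_of_not_AdmS hη h4.2.1⟩
  have hadj : ∑ B ∈ S.filter (Block.IsAdjacent L ℓ), ((2 : ℝ) ^ (d * B.level))⁻¹ ≤
      (Finset.Ioc ℓ L).card * ((2 : ℕ) : ℝ) ^ d := by
    -- The window holds all children of the common parent, the cube itself included.
    refine sum_inv_two_pow_levels_le (fun i k => 2 * (i k / 2)) (fun i k => 2 * (i k / 2) + 1)
      (fun B hB => ?_) fun i k => by omega
    obtain ⟨h1, h2, h3, h4⟩ := (Finset.mem_filter.1 hB).2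
    refine ⟨Finset.mem_Ioc.2 ⟨h1, h2⟩, h3, fun k => ?_⟩
    have := congrFun h4.2.2 k
    simp only [parentIdx] at this
    omega
  have hsplit : ∑ B ∈ S, ((2 : ℝ) ^ (d * B.level))⁻¹ ≤
      ∑ B ∈ S.filter (T.IsFar η ℓ), ((2 : ℝ) ^ (d * B.level))⁻¹ +
      ∑ B ∈ S.filter (T.IsNeighbor η ℓ), ((2 : ℝ) ^ (d * B.level))⁻¹ +
      ∑ B ∈ S.filter (Block.IsAdjacent L ℓ), ((2 : ℝ) ^ (d * B.level))⁻¹ := by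
    rw [Finset.sum_filter, Finset.sum_filter, Finset.sum_filter, ← Finset.sum_add_distrib,
      ← Finset.sum_add_distrib]
    refine Finset.sum_le_sum fun B hB => ?_
    have h0 : 0 ≤ ((2 : ℝ) ^ (d * B.level))⁻¹ := by positivity
    rcases (hS B hB).1 with h | h | h <;> simp only [h, if_true] <;> split_ifs <;> linarith
  refine hsplit.trans ?_
  have h1 : ((Finset.Ioc ℓ L).card : ℝ) = (L : ℝ) - ℓ := by simp [Nat.cast_sub hℓ]
  rw [h1] at hadj
  simp only [Nat.card_Icc, Finset.card_singleton, Nat.add_sub_cancel] at hfar hnbr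
  push_cast at hfar hnbr hadj
  linarith

theorem three_le_one_add_two_mul_ceil_pow (hd : 1 ≤ d) (hη : 0 < η) :
    3 ≤ (1 + 2 * (⌈√(d : ℝ) / η⌉₊ : ℝ)) ^ d := by
  have h1 : (1 : ℝ) ≤ ⌈√(d : ℝ) / η⌉₊ := by
    have : 0 < ⌈√(d : ℝ) / η⌉₊ :=
      Nat.ceil_pos.2 (div_pos (Real.sqrt_pos.2 (by exact_mod_cast hd)) hη)
    exact_mod_cast this
  calc (3 : ℝ) ≤ 1 + 2 * (⌈√(d : ℝ) / η⌉₊ : ℝ) := by linarith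
    _ ≤ _ := le_self_pow₀ (by linarith) (by omega)

/-- The factor `2` pays for the window counts, which miss the `- 1` in the constants: `2^d ≤ 2 (2^d
- 1)`, and `M ≤ 2 (M - 1)` for `M ≥ 3`. -/
theorem ClusterTree.sum_admissible_le_two_mul (hd : 1 ≤ d) (hη : 0 < η) (hℓ : ℓ ≤ L)
    {S : Finset (Block d)} (hS : ∀ B ∈ S, T.IsAdmissible η ℓ B) :
    ∑ B ∈ S, ((2 : ℝ) ^ (d * B.level))⁻¹ ≤
      2 * (ℓ * constFar d η + constNeighbor d η + ((L : ℝ) - ℓ) * constAdjacent d) := by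
  refine (T.sum_admissible_le hη hℓ hS).trans ?_
  have hM := three_le_one_add_two_mul_ceil_pow hd hη
  rw [mul_pow]
  unfold constFar constNeighbor constAdjacent
  set M := (1 + 2 * (⌈√(d : ℝ) / η⌉₊ : ℝ)) ^ d
  have h2 : (2 : ℝ) ≤ 2 ^ d := le_self_pow₀ one_le_two (by omega)
  have h3 : (0 : ℝ) ≤ (L : ℝ) - ℓ := by
    rw [sub_nonneg]; exact_mod_cast hℓ
  have h4 : (ℓ : ℝ) * (2 ^ d * M) ≤ ℓ * ((2 * (2 ^ d - 1)) * M) := by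
    gcongr
    linarith
  have h5 : ((L : ℝ) - ℓ) * 2 ^ d ≤ ((L : ℝ) - ℓ) * (2 * (2 ^ d - 1)) := by
    gcongr
    linarith
  linarith

theorem two_le_block_constant (hd : 1 ≤ d) (hη : 0 < η) (hℓ : ℓ ≤ L) :
    2 ≤ ℓ * constFar d η + constNeighbor d η + ((L : ℝ) - ℓ) * constAdjacent d := by
  have hM := three_le_one_add_two_mul_ceil_pow hd hη
  unfold constFar constNeighbor constAdjacent
  have h2 : (0 : ℝ) ≤ 2 ^ d - 1 := by
    rw [sub_nonneg]; exact one_le_pow₀ one_le_two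
  have h3 : (0 : ℝ) ≤ (L : ℝ) - ℓ := by
    rw [sub_nonneg]; exact_mod_cast hℓ
  have h4 : (0 : ℝ) ≤ ℓ * ((2 ^ d - 1) * (1 + 2 * (⌈√(d : ℝ) / η⌉₊ : ℝ)) ^ d) := by positivity
  have h5 := mul_nonneg h3 h2
  linarith

end Counting

/-! ## Sums over the block partition -/

section Partition

namespace ClusterTree

variable {d N L : ℕ} (T : ClusterTree d N L) {η : ℝ} {ℓ : ℕ} {S : Finset (Block d)}

/-- The extension by zero of a vector indexed by the rows of a block. -/
noncomputable def extend (B : Block d) (y : T.rows B → ℝ) (r : Fin N) : ℝ :=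
  if h : r ∈ T.rows B then y ⟨r, h⟩ else 0

theorem extend_of_mem {B : Block d} (y : T.rows B → ℝ) {r : Fin N} (h : r ∈ T.rows B) :
    T.extend B y r = y ⟨r, h⟩ := dif_pos h

theorem extend_of_notMem {B : Block d} (y : T.rows B → ℝ) {r : Fin N} (h : r ∉ T.rows B) :
    T.extend B y r = 0 := dif_neg h

/-- The entries of a vector that belong to the columns of a block. -/
def restrictCols (x : Fin N → ℝ) (B : Block d) : T.cols B → ℝ := fun j => x j

theorem sum_cols_blocks (hd : 1 ≤ d) (hη : 0 < η) (hℓ : ℓ ≤ L)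
    (hS : ∀ B, B ∈ S ↔ T.IsBlock η ℓ B) (r : Fin N) (f : Fin N → ℝ) :
    ∑ B ∈ S.filter (r ∈ T.rows ·), ∑ j ∈ T.cols B, f j = ∑ j, f j := by
  classical
  rw [← Finset.sum_biUnion]
  · refine Finset.sum_congr (Finset.eq_univ_iff_forall.2 fun j => ?_) fun _ _ => rfl
    obtain ⟨B, ⟨hB, hr, hj⟩, -⟩ := T.existsUnique_isBlock hd hη hℓ r j
    exact Finset.mem_biUnion.2 ⟨B, Finset.mem_filter.2 ⟨(hS B).2 hB, hr⟩, hj⟩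
  · intro B hB B' hB' hne
    obtain ⟨h1, h2⟩ := Finset.mem_filter.1 hB
    obtain ⟨h1', h2'⟩ := Finset.mem_filter.1 hB'
    refine Finset.disjoint_left.2 fun j hj hj' => hne ?_
    exact (T.existsUnique_isBlock hd hη hℓ r j).unique ⟨(hS B).1 h1, h2, hj⟩
      ⟨(hS B').1 h1', h2', hj'⟩

theorem sum_blocks_rows (g : Block d → Fin N → ℝ) :
    ∑ B ∈ S, ∑ i : T.rows B, g B i = ∑ r, ∑ B ∈ S.filter (r ∈ T.rows ·), g B r := by
  simp_rw [Finset.sum_filter]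
  rw [Finset.sum_comm]
  refine Finset.sum_congr rfl fun B _ => ?_
  rw [Finset.sum_coe_sort (T.rows B) (g B), Finset.sum_ite_mem, Finset.univ_inter]

theorem sum_norm_sub_sq (hd : 1 ≤ d) (hη : 0 < η) (hℓ : ℓ ≤ L)
    (hS : ∀ B, B ∈ S ↔ T.IsBlock η ℓ B) (A : Matrix (Fin N) (Fin N) ℝ) :
    ∑ B ∈ S, ‖T.sub A B‖ ^ 2 = ‖A‖ ^ 2 := by
  calc _ = ∑ B ∈ S, ∑ i : T.rows B, ∑ j ∈ T.cols B, A i j ^ 2 := by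
        refine Finset.sum_congr rfl fun B _ => ?_
        rw [frobenius_norm_sq]
        refine Finset.sum_congr rfl fun i _ => ?_
        exact Finset.sum_coe_sort (T.cols B) fun j => A i j ^ 2
    _ = _ := by
        rw [T.sum_blocks_rows fun B i => ∑ j ∈ T.cols B, A i j ^ 2, frobenius_norm_sq]
        exact Finset.sum_congr rfl fun r _ => T.sum_cols_blocks hd hη hℓ hS r _

/-- The column sets of these blocks are nonempty and partition `N` indices. This bounds the number
of updates that an entry of `b` receives. -/
theorem card_blocks_of_row_le (hd : 1 ≤ d) (hη : 0 < η) (hℓ : ℓ ≤ L)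
    (hS : ∀ B, B ∈ S ↔ T.IsBlock η ℓ B) (r : Fin N) :
    (S.filter (r ∈ T.rows ·)).card ≤ N := by
  have h1 := T.sum_cols_blocks hd hη hℓ hS r fun _ => 1
  have h2 : ∑ B ∈ S.filter (r ∈ T.rows ·), (1 : ℝ) ≤
      ∑ B ∈ S.filter (r ∈ T.rows ·), ∑ j ∈ T.cols B, (1 : ℝ) := by
    refine Finset.sum_le_sum fun B hB => ?_
    have hne : (T.cols B).Nonempty := by
      rcases (hS B).1 (Finset.mem_filter.1 hB).1 with h | ⟨h1, h2, h3, h4⟩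
      · exact h.2.2
      · unfold cols
        rw [h3]
        exact h4
    simpa using hne
  rw [h1] at h2
  have h3 : ((S.filter (r ∈ T.rows ·)).card : ℝ) ≤ N := by simpa using h2
  exact_mod_cast h3

theorem mulVec_eq_sum_blocks (hd : 1 ≤ d) (hη : 0 < η) (hℓ : ℓ ≤ L)
    (hS : ∀ B, B ∈ S ↔ T.IsBlock η ℓ B) (A : Matrix (Fin N) (Fin N) ℝ) (x : Fin N → ℝ)
    (r : Fin N) :
    (A *ᵥ x) r = ∑ B ∈ S, T.extend B (T.sub A B *ᵥ T.restrictCols x B) r := by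
  simp only [Matrix.mulVec, dotProduct]
  rw [← T.sum_cols_blocks hd hη hℓ hS r, Finset.sum_filter]
  refine Finset.sum_congr rfl fun B _ => ?_
  split_ifs with h
  · rw [T.extend_of_mem _ h]
    exact (Finset.sum_coe_sort (T.cols B) fun j => A r j * x j).symm
  · rw [T.extend_of_notMem _ h]

/-- In each row, Cauchy–Schwarz separates the ratios `|e_B(r)| / ‖x_J‖` from the norms `‖x_J‖`. The
squares of the latter sum to `‖x‖²` since the column sets partition the indices; those of the
former, summed over all rows, are bounded by `∑ μ_B²`. -/
theorem vecNorm_sum_extend_le (hd : 1 ≤ d) (hη : 0 < η) (hℓ : ℓ ≤ L)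
    (hS : ∀ B, B ∈ S ↔ T.IsBlock η ℓ B) {x : Fin N → ℝ} {e : (B : Block d) → T.rows B → ℝ}
    {μ : Block d → ℝ} {C : ℝ} (hC : 0 ≤ C)
    (he : ∀ B ∈ S, vecNorm (e B) ≤ μ B * vecNorm (T.restrictCols x B))
    (hμ : ∑ B ∈ S, μ B ^ 2 ≤ C ^ 2) :
    vecNorm (fun r => ∑ B ∈ S, |T.extend B (e B) r|) ≤ C * vecNorm x := by
  set n : Block d → ℝ := fun B => vecNorm (T.restrictCols x B)
  have hn : ∀ B, 0 ≤ n B := fun B => vecNorm_nonneg _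
  have hn2 : ∀ r, ∑ B ∈ S.filter (r ∈ T.rows ·), n B ^ 2 = vecNorm x ^ 2 := fun r => by
    rw [vecNorm_sq, ← T.sum_cols_blocks hd hη hℓ hS r]
    refine Finset.sum_congr rfl fun B _ => ?_
    rw [vecNorm_sq]
    exact Finset.sum_coe_sort (T.cols B) fun j => x j ^ 2
  -- If `n B = 0` the quotient is `0`, which is harmless because `e B` then vanishes by `he`.
  set t : Block d → Fin N → ℝ := fun B r => |T.extend B (e B) r| / n B
  have ht : ∀ r, ∀ B ∈ S, |T.extend B (e B) r| = t B r * n B := by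
    intro r B hB
    rcases (hn B).eq_or_lt with h0 | h0
    · have h1 := he B hB
      change _ ≤ μ B * n B at h1
      rw [← h0, mul_zero, vecNorm_le_iff le_rfl] at h1
      rw [← h0, mul_zero, abs_eq_zero]
      by_cases hr : r ∈ T.rows B
      · rw [T.extend_of_mem _ hr]
        have h2 := (Finset.single_le_sum (f := fun i => e B i ^ 2) (fun _ _ => sq_nonneg _)
          (Finset.mem_univ ⟨r, hr⟩)).trans h1
        exact pow_eq_zero_iff two_ne_zero |>.1
          (le_antisymm (h2.trans (by norm_num)) (sq_nonneg _))
      · exact T.extend_of_notMem _ hr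
    · exact (div_mul_cancel₀ _ h0.ne').symm
  have ht2 : ∀ B ∈ S, ∑ i : T.rows B, t B i ^ 2 ≤ μ B ^ 2 := by
    intro B hB
    have h1 : ∑ i : T.rows B, t B i ^ 2 = (vecNorm (e B) / n B) ^ 2 := by
      rw [div_pow, vecNorm_sq, Finset.sum_div]
      refine Finset.sum_congr rfl fun i _ => ?_
      rw [div_pow, sq_abs, T.extend_of_mem _ i.2]
    rw [h1]
    rcases (hn B).eq_or_lt with h0 | h0
    · simpa [← h0] using sq_nonneg (μ B)
    · exact pow_le_pow_left₀ (div_nonneg (vecNorm_nonneg _) (hn B))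
        ((div_le_iff₀ h0).2 (he B hB)) 2
  rw [vecNorm_le_iff (mul_nonneg hC (vecNorm_nonneg x)), mul_pow]
  calc ∑ r, (∑ B ∈ S, |T.extend B (e B) r|) ^ 2
      = ∑ r, (∑ B ∈ S.filter (r ∈ T.rows ·), t B r * n B) ^ 2 := by
        refine Finset.sum_congr rfl fun r _ => ?_
        congr 1
        rw [Finset.sum_filter]
        refine Finset.sum_congr rfl fun B hB => ?_
        rw [← ht r B hB]
        split_ifs with h
        · rfl
        · rw [T.extend_of_notMem _ h, abs_zero]
    _ ≤ ∑ r, (∑ B ∈ S.filter (r ∈ T.rows ·), t B r ^ 2) * vecNorm x ^ 2 := by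
        refine Finset.sum_le_sum fun r _ => ?_
        rw [← hn2 r]
        exact Finset.sum_mul_sq_le_sq_mul_sq _ _ _
    _ = (∑ B ∈ S, ∑ i : T.rows B, t B i ^ 2) * vecNorm x ^ 2 := by
        rw [← Finset.sum_mul, T.sum_blocks_rows fun B i => t B i ^ 2]
    _ ≤ C ^ 2 * vecNorm x ^ 2 := by
        gcongr
        exact (Finset.sum_le_sum ht2).trans hμ

end ClusterTree

/-- Minkowski's inequality, squared. -/
theorem sum_add_sq_le {α : Type*} {s : Finset α} {f g : α → ℝ} {A B : ℝ} (hA : 0 ≤ A) (hB : 0 ≤ B)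
    (hf : ∑ a ∈ s, f a ^ 2 ≤ A ^ 2) (hg : ∑ a ∈ s, g a ^ 2 ≤ B ^ 2) :
    ∑ a ∈ s, (f a + g a) ^ 2 ≤ (A + B) ^ 2 := by
  have h1 : ∑ a ∈ s, f a * g a ≤ A * B := by
    refine (abs_le_of_sq_le_sq' ?_ (mul_nonneg hA hB)).2
    rw [mul_pow]
    exact (Finset.sum_mul_sq_le_sq_mul_sq _ _ _).trans
      (mul_le_mul hf hg (Finset.sum_nonneg fun _ _ => sq_nonneg _) (sq_nonneg A))
  have h2 : ∑ a ∈ s, (f a + g a) ^ 2 =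
      ∑ a ∈ s, f a ^ 2 + 2 * ∑ a ∈ s, f a * g a + ∑ a ∈ s, g a ^ 2 := by
    rw [Finset.mul_sum, ← Finset.sum_add_distrib, ← Finset.sum_add_distrib]
    exact Finset.sum_congr rfl fun a _ => by ring
  rw [h2]
  nlinarith

end Partition

/-! ## Accumulation of the block products -/

section Accumulation

variable {d N L : ℕ} {T : ClusterTree d N L} {F : HhFormat d} {R : HhRep T F}

/-- Entry `r` is rounded only when a block containing row `r` is processed, so the exponent counts
these blocks alone. -/
theorem HhRep.FlRun.exists_products {w : ℝ} (hw : 0 ≤ w) {x b : Fin N → ℝ} {bs : List (Block d)}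
    (h : R.FlRun w x bs b) (hnd : bs.Nodup) :
    ∃ y : (B : Block d) → T.rows B → ℝ, (∀ B ∈ bs, R.FlBlockMul w x B (y B)) ∧
      ∀ r, |b r - (bs.map fun B => T.extend B (y B) r).sum| ≤
        ((1 + w) ^ bs.countP (fun B => decide (r ∈ T.rows B)) - 1) *
          (bs.map fun B => |T.extend B (y B) r|).sum := by
  classical
  induction h with
  | start => exact ⟨fun _ _ => 0, by simp, by simp⟩
  | @step bs b b' B yB _ hB hin hout ih =>
    obtain ⟨hBbs, hnd⟩ := List.nodup_cons.1 hnd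
    obtain ⟨y, hy, hbound⟩ := ih hnd
    have hne : ∀ B' ∈ bs, Function.update y B yB B' = y B' := fun B' hB' =>
      Function.update_of_ne (by rintro rfl; exact hBbs hB') _ _
    refine ⟨Function.update y B yB, ?_, fun r => ?_⟩
    · intro B' hB'
      rcases List.mem_cons.1 hB' with rfl | hB'
      · rwa [Function.update_self]
      · rw [hne B' hB']
        exact hy B' hB'
    have e1 : bs.map (fun B' => T.extend B' (Function.update y B yB B') r) =
        bs.map fun B' => T.extend B' (y B') r :=
      List.map_congr_left fun B' hB' => by rw [hne B' hB']
    have e2 : bs.map (fun B' => |T.extend B' (Function.update y B yB B') r|) =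
        bs.map fun B' => |T.extend B' (y B') r| :=
      List.map_congr_left fun B' hB' => by rw [hne B' hB']
    rw [List.map_cons, List.map_cons, List.sum_cons, List.sum_cons, e1, e2, Function.update_self,
      List.countP_cons]
    specialize hbound r
    set P := (bs.map fun B' => T.extend B' (y B') r).sum with hP
    have hle : |P| ≤ (bs.map fun B' => |T.extend B' (y B') r|).sum := by
      rw [hP]
      clear * -
      induction bs with
      | nil => simp
      | cons a l ih => simpa using (abs_add_le _ _).trans (by gcongr)
    set A := (bs.map fun B' => |T.extend B' (y B') r|).sum
    set k := bs.countP fun B => decide (r ∈ T.rows B)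
    by_cases hr : r ∈ T.rows B
    · rw [T.extend_of_mem _ hr, if_pos (by simpa using hr), pow_succ]
      have h1 := (hin ⟨r, hr⟩).abs_sub_le
      set v := yB ⟨r, hr⟩
      simp only at h1
      have h2 : |b r + v| ≤ |b r - P| + |P| + |v| := by
        have a1 := abs_add_le (b r - P + P) v
        have a2 := abs_add_le (b r - P) P
        rw [sub_add_cancel] at a1 a2
        linarith
      have h3 : |b' r - (v + P)| ≤ |b' r - (b r + v)| + |b r - P| := by
        have := abs_add_le (b' r - (b r + v)) (b r - P)
        rwa [show b' r - (b r + v) + (b r - P) = b' r - (v + P) by ring] at this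
      have h4 : |b r + v| ≤ (1 + w) ^ k * (A + |v|) := by
        have := mul_nonneg (sub_nonneg.2 (one_le_one_add_pow hw k)) (abs_nonneg v)
        linarith
      have h5 := mul_le_mul_of_nonneg_left h4 hw
      have h6 := mul_nonneg (sub_nonneg.2 (one_le_one_add_pow hw k)) (abs_nonneg v)
      linarith
    · rw [T.extend_of_notMem _ hr, if_neg (by simpa using hr), hout r hr]
      simpa using hbound

/-- The computed product differs from the sum of the computed block products by accumulated
rounding errors only. -/
theorem HhRep.FlProduct.exists_products {η w : ℝ} {ℓ : ℕ} (hd : 1 ≤ d) (hη : 0 < η) (hℓ : ℓ ≤ L)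
    (hw : 0 ≤ w) {x b : Fin N → ℝ} (h : R.FlProduct η ℓ w x b) :
    ∃ (S : Finset (Block d)) (y : (B : Block d) → T.rows B → ℝ),
      (∀ B, B ∈ S ↔ T.IsBlock η ℓ B) ∧ (∀ B ∈ S, R.FlBlockMul w x B (y B)) ∧
      ∀ r, |b r - ∑ B ∈ S, T.extend B (y B) r| ≤
        ((1 + w) ^ N - 1) * ∑ B ∈ S, |T.extend B (y B) r| := by
  classical
  obtain ⟨bs, hnd, hbs, hrun⟩ := h
  obtain ⟨y, hy, hbound⟩ := hrun.exists_products hw hnd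
  have hS : ∀ B, B ∈ bs.toFinset ↔ T.IsBlock η ℓ B := fun B => by rw [List.mem_toFinset, hbs]
  refine ⟨bs.toFinset, y, hS, fun B hB => hy B (List.mem_toFinset.1 hB), fun r => ?_⟩
  rw [List.sum_toFinset _ hnd, List.sum_toFinset _ hnd]
  refine (hbound r).trans ?_
  have hk : bs.countP (fun B => decide (r ∈ T.rows B)) ≤ N := by
    refine le_of_eq_of_le ?_ (T.card_blocks_of_row_le hd hη hℓ hS r)
    rw [List.countP_eq_length_filter, ← List.toFinset_card_of_nodup (hnd.filter _),
      List.toFinset_filter]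
    simp
  gcongr
  · exact List.sum_nonneg (by simp)
  · linarith

end Accumulation

/-! ## The total error -/

section TotalError

variable {d N L : ℕ} {T : ClusterTree d N L} {F : HhFormat d} {η ε κ u : ℝ} {ℓ p : ℕ}
  {H Ht : Matrix (Fin N) (Fin N) ℝ} {R Rh : HhRep T F} {S : Finset (Block d)}

theorem IsHhMatrix.admissible_of_not_dense (hH : IsHhMatrix T F η ℓ p ε κ u H Ht R) {B : Block d}
    (hB : T.IsBlock η ℓ B) (hd : B ∉ F.dense) : T.IsAdmissible η ℓ B :=
  hB.resolve_right fun h => hd (hH.diagonal_dense B h)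

theorem IsHhMatrix.sub_eq_of_dense (hH : IsHhMatrix T F η ℓ p ε κ u H Ht R) {B : Block d}
    (hB : T.IsBlock η ℓ B) (hd : B ∈ F.dense) : T.sub Ht B = T.sub H B := by
  rw [hH.assemble B hB, HhRep.block, if_pos hd, hH.dense_eq B hB hd]

theorem IsHhMatrix.sub_eq_of_not_dense (hH : IsHhMatrix T F η ℓ p ε κ u H Ht R) {B : Block d}
    (hB : T.IsBlock η ℓ B) (hd : B ∉ F.dense) : T.sub Ht B = R.U B * (R.V B)ᵀ := by
  rw [hH.assemble B hB, HhRep.block, if_neg hd]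

theorem IsHhMatrix.norm_sub_sub_le (hH : IsHhMatrix T F η ℓ p ε κ u H Ht R) (hε : 0 ≤ ε)
    {B : Block d} (hB : T.IsBlock η ℓ B) :
    ‖T.sub H B - T.sub Ht B‖ ≤ ε * ‖T.sub H B‖ := by
  by_cases hd : B ∈ F.dense
  · rw [hH.sub_eq_of_dense hB hd, sub_self, norm_zero]
    positivity
  · rw [hH.sub_eq_of_not_dense hB hd]
    exact hH.accuracy B (hH.admissible_of_not_dense hB hd) hd

theorem IsHhMatrix.norm_sub_le (hH : IsHhMatrix T F η ℓ p ε κ u H Ht R) (hε : 0 ≤ ε)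
    (hd : 1 ≤ d) (hη : 0 < η) (hℓ : ℓ ≤ L) (hS : ∀ B, B ∈ S ↔ T.IsBlock η ℓ B) :
    ‖H - Ht‖ ≤ ε * ‖H‖ := by
  refine le_of_sq_le_sq ?_ (by positivity)
  rw [mul_pow, ← T.sum_norm_sub_sq hd hη hℓ hS, ← T.sum_norm_sub_sq hd hη hℓ hS H, Finset.mul_sum]
  refine Finset.sum_le_sum fun B hB => ?_
  rw [← mul_pow]
  exact pow_le_pow_left₀ (norm_nonneg _) (hH.norm_sub_sub_le hε ((hS B).1 hB)) 2

theorem norm_le_of_norm_sub_le {E : Type*} [SeminormedAddCommGroup E] {a a' : E} {δ : ℝ}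
    (h : ‖a - a'‖ ≤ δ * ‖a‖) : ‖a'‖ ≤ (1 + δ) * ‖a‖ := by
  have := norm_sub_norm_le a' a
  rw [norm_sub_rev] at this
  linarith

theorem IsAdaptive.prec_mul_norm_le {𝒰 : Finset ℝ} {prec : Block d → ℝ}
    (hA : IsAdaptive T F η ℓ ε u 𝒰 Ht R Rh prec) (hd : 1 ≤ d) (hη : 0 < η)
    (hℓ : ℓ ≤ L) (hS : ∀ B, B ∈ S ↔ T.IsBlock η ℓ B) {B : Block d}
    (hB : T.IsAdmissible η ℓ B) (hBd : B ∉ F.dense) :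
    prec B * ‖T.sub Ht B‖ ≤ ε * (√((2 : ℝ) ^ (d * B.level))⁻¹ * ‖Ht‖) := by
  have h1 := (hA.precision B hB hBd).1.2
  have hpow : (2 : ℝ) ^ ((d * B.level : ℝ) / 2) = √((2 : ℝ) ^ (d * B.level)) := by
    rw [Real.sqrt_eq_rpow, ← Real.rpow_natCast, ← Real.rpow_mul zero_le_two]
    congr 1
    push_cast
    ring
  have hpos : 0 < √((2 : ℝ) ^ (d * B.level)) := Real.sqrt_pos.2 (by positivity)
  rw [hpow] at h1
  rw [Real.sqrt_inv]
  -- If `Ht = 0` then `ξ` is `0` by convention and says nothing, but the block vanishes too.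
  rcases (norm_nonneg Ht).eq_or_lt with h0 | h0
  · have h2 := T.sum_norm_sub_sq hd hη hℓ hS Ht
    have h3 := Finset.single_le_sum (f := fun B => ‖T.sub Ht B‖ ^ 2)
      (fun _ _ => sq_nonneg _) ((hS B).2 (.inl hB))
    rw [h2, ← h0] at h3
    have h4 : ‖T.sub Ht B‖ = 0 := pow_eq_zero_iff two_ne_zero |>.1
      (le_antisymm (h3.trans (by norm_num)) (sq_nonneg _))
    rw [h4, ← h0]
    simp
  · calc prec B * ‖T.sub Ht B‖ =
          prec B * (√((2 : ℝ) ^ (d * B.level)) * (‖T.sub Ht B‖ / ‖Ht‖)) *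
            ((√((2 : ℝ) ^ (d * B.level)))⁻¹ * ‖Ht‖) := by field_simp
      _ ≤ _ := by gcongr

open Classical in
/-- The weight `2^(-d l / 2)` of a compressed block of level `l`. -/
noncomputable def blockWeight (F : HhFormat d) (B : Block d) : ℝ :=
  if B ∈ F.dense then 0 else √((2 : ℝ) ^ (d * B.level))⁻¹

theorem blockWeight_nonneg (F : HhFormat d) (B : Block d) : 0 ≤ blockWeight F B := by
  unfold blockWeight
  split_ifs <;> positivity

theorem IsHhMatrix.sum_blockWeight_sq_le (hH : IsHhMatrix T F η ℓ p ε κ u H Ht R)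
    (hd : 1 ≤ d) (hη : 0 < η) (hℓ : ℓ ≤ L) (hS : ∀ B, B ∈ S ↔ T.IsBlock η ℓ B) :
    ∑ B ∈ S, blockWeight F B ^ 2 ≤
      2 * (ℓ * constFar d η + constNeighbor d η + ((L : ℝ) - ℓ) * constAdjacent d) := by
  classical
  refine le_trans (le_of_eq ?_) (T.sum_admissible_le_two_mul (S := S.filter (· ∉ F.dense))
    hd hη hℓ fun B hB => ?_)
  · rw [Finset.sum_filter]
    refine Finset.sum_congr rfl fun B _ => ?_
    unfold blockWeight
    by_cases h : B ∈ F.dense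
    · simp [h]
    · rw [if_neg h, if_pos h, Real.sq_sqrt (by positivity)]
  · obtain ⟨h1, h2⟩ := Finset.mem_filter.1 hB
    exact hH.admissible_of_not_dense ((hS B).1 h1) h2

/-- The error of a single block product. -/
theorem vecNorm_block_error_le {𝒰 : Finset ℝ} {prec : Block d → ℝ} {w : ℝ} {x : Fin N → ℝ}
    (hH : IsHhMatrix T F η ℓ p ε κ u H Ht R) (hA : IsAdaptive T F η ℓ ε u 𝒰 Ht R Rh prec)
    (hd : 1 ≤ d) (hη : 0 < η) (hℓ : ℓ ≤ L) (hS : ∀ B, B ∈ S ↔ T.IsBlock η ℓ B)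
    (hu : 0 < u) (huε : u < ε) (h𝒰 : ∀ v ∈ 𝒰, u ≤ v) (hp : 1 ≤ p) (hκu : κ * u ≤ 1 / 1000)
    (hpε : √(p : ℝ) * ε ≤ 1 / 1000)
    (hprec : ∀ B, T.IsAdmissible η ℓ B → B ∉ F.dense → √(p : ℝ) * prec B ≤ 1 / 1000)
    (hw : 0 ≤ w) (hNw : N * w ≤ ε) {B : Block d} (hB : B ∈ S) {y : T.rows B → ℝ}
    (hy : Rh.FlBlockMul w x B y) :
    vecNorm (y - T.sub H B *ᵥ T.restrictCols x B) ≤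
      1.0122 * (2 * ε * (blockWeight F B * ‖H‖) + 2 * ε * ‖T.sub H B‖) *
        vecNorm (T.restrictCols x B) := by
  have hε : 0 < ε := hu.trans huε
  have hp1 : 1 ≤ √(p : ℝ) := Real.one_le_sqrt.2 (by exact_mod_cast hp)
  have hε1 : ε ≤ 1 / 1000 := (le_mul_of_one_le_left hε.le hp1).trans hpε
  have hBb := (hS B).1 hB
  set n := vecNorm (T.restrictCols x B)
  have hn : 0 ≤ n := vecNorm_nonneg _
  set h := ‖T.sub H B‖
  have hh : 0 ≤ h := norm_nonneg _
  have hcols : (Fintype.card (T.cols B) : ℝ) * w ≤ ε := by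
    refine le_trans ?_ hNw
    gcongr
    rw [Fintype.card_coe]
    simpa using Finset.card_le_univ (T.cols B)
  rcases hy with ⟨hBd, hy⟩ | ⟨hBd, z, hz, hy⟩
  · have h1 := FlMulVec.vecNorm_sub_le hu.le hw (hA.round_D B hBb hBd) hy
    rw [hH.dense_eq B hBb hBd] at h1
    change vecNorm (y - T.sub H B *ᵥ T.restrictCols x B) ≤ _ * (h * n) at h1
    have h2 := rounding_factor_sub_one_le hu.le hw hcols hε1 (by linarith)
    refine h1.trans ?_
    rw [blockWeight, if_pos hBd]
    calc _ ≤ (u + 1.003 * ε) * (h * n) := by gcongr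
      _ ≤ (2.003 * ε) * (h * n) := by
          gcongr
          linarith
      _ ≤ (2.0244 * ε) * (h * n) := by
          gcongr
          norm_num
      _ = _ := by ring
  · have hadm := hH.admissible_of_not_dense hBb hBd
    obtain ⟨W, σ, hV, hW⟩ := hH.right_svd B hadm hBd
    set q := prec B
    have hq : 0 ≤ q := by
      rcases (hA.precision B hadm hBd).1.1 with h | h
      · exact hu.le.trans_eq h.symm
      · exact hu.le.trans (h𝒰 _ h)
    have hq1 : q ≤ 1 / 1000 := (le_mul_of_one_le_left hq hp1).trans (hprec B hadm hBd)
    have hr : √(Fintype.card (Fin (F.rank B)) : ℝ) ≤ √(p : ℝ) := by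
      rw [Fintype.card_fin]
      exact Real.sqrt_le_sqrt (by exact_mod_cast hH.rank_le B hadm hBd)
    -- A compressed block is off-diagonal, so `|I| + |J| ≤ N`.
    have hcard : ((Fintype.card (T.cols B) + Fintype.card (T.rows B) : ℕ) : ℝ) * w ≤ ε := by
      refine le_trans ?_ hNw
      gcongr
      rw [Fintype.card_coe, Fintype.card_coe]
      exact T.card_cols_add_card_rows_le hd hη hadm
    have h1 := vecNorm_lowRank_sub_le_of_small hq hw (hH.left_orthonormal B hadm hBd) hW hV
      (hA.round_U B hadm hBd) (hA.round_V B hadm hBd) hz hy hκu hε1 hq1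
      ((mul_le_mul_of_nonneg_right hr hε.le).trans hpε)
      ((mul_le_mul_of_nonneg_right hr hq).trans (hprec B hadm hBd)) hcard
    rw [← hH.sub_eq_of_not_dense hBb hBd] at h1
    change vecNorm (y - T.sub Ht B *ᵥ T.restrictCols x B) ≤ 1.011 * ((2 * q + ε) * (‖T.sub Ht B‖ * n)) at h1
    have h2 := hH.norm_sub_sub_le hε.le hBb
    have h3 : ‖T.sub Ht B‖ ≤ 1.001 * h :=
      (norm_le_of_norm_sub_le h2).trans (by gcongr; linarith)
    have h4 : ‖Ht‖ ≤ 1.001 * ‖H‖ :=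
      (norm_le_of_norm_sub_le (hH.norm_sub_le hε.le hd hη hℓ hS)).trans (by gcongr; linarith)
    have h5 := hA.prec_mul_norm_le hd hη hℓ hS hadm hBd
    rw [show √((2 : ℝ) ^ (d * B.level))⁻¹ = blockWeight F B by rw [blockWeight, if_neg hBd]] at h5
    have hs := blockWeight_nonneg F B
    set s := blockWeight F B
    have h6 : q * ‖T.sub Ht B‖ ≤ ε * (s * (1.001 * ‖H‖)) := h5.trans (by gcongr)
    have h7 : vecNorm ((T.sub Ht B - T.sub H B) *ᵥ T.restrictCols x B) ≤ ε * h * n := by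
      refine (vecNorm_mulVec_le _ _).trans ?_
      rw [norm_sub_rev]
      gcongr
    have h8 := vecNorm_add_le (y - T.sub Ht B *ᵥ T.restrictCols x B)
      ((T.sub Ht B - T.sub H B) *ᵥ T.restrictCols x B)
    rw [Matrix.sub_mulVec, sub_add_sub_cancel, ← Matrix.sub_mulVec] at h8
    -- `2 q` is converted by the choice of the precision; the `ε` of the arithmetic stays with the
    -- block. The truncation error `h7` supplies the second `ε * h`.
    have h9 : (2 * q + ε) * ‖T.sub Ht B‖ ≤
        1.001 * (2 * ε * (s * ‖H‖) + ε * h) := by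
      have := mul_le_mul_of_nonneg_left h3 hε.le
      linarith
    have h10 := mul_le_mul_of_nonneg_right h9 hn
    have h11 : 0 ≤ ε * (s * ‖H‖) * n := by positivity
    have h12 : 0 ≤ ε * h * n := by positivity
    linarith

end TotalError

/-! ### The final estimate -/

theorem theorem4p3 (κ : ℝ) (hκ : 0 ≤ κ) :
    ∃ c : ℝ, 0 < c ∧
      ∀ (d N L ℓ p : ℕ) (T : ClusterTree d N L) (F : HhFormat d)
        (η ε u w : ℝ) (𝒰 : Finset ℝ) (H Ht : Matrix (Fin N) (Fin N) ℝ)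
        (R Rh : HhRep T F) (prec : Block d → ℝ) (x b : Fin N → ℝ),
        1 ≤ d → ℓ ≤ L → 1 ≤ p → 0 < η →
        0 < u → u < ε → (∀ v ∈ 𝒰, u ≤ v) →
        IsHhMatrix T F η ℓ p ε κ u H Ht R →
        IsAdaptive T F η ℓ ε u 𝒰 Ht R Rh prec →
        √(p : ℝ) * ε ≤ c →
        (∀ B, T.IsAdmissible η ℓ B → B ∉ F.dense → √(p : ℝ) * prec B ≤ c) →
        0 ≤ w → N * w ≤ ε →
        Rh.FlProduct η ℓ w x b →
        ∃ ΔH : Matrix (Fin N) (Fin N) ℝ,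
          b = (H + ΔH) *ᵥ x ∧
          ‖ΔH‖ ≤ 2 * (2 * √(ℓ * constFar d η + constNeighbor d η +
            ((L : ℝ) - ℓ) * constAdjacent d) + 1) * ε * ‖H‖ := by
  -- As `√p ≥ 1` and `u < ε`, this makes `ε` and the orthonormality defect `κ u` at most `1/1000`.
  refine ⟨1 / (1000 * (1 + κ)), by positivity, ?_⟩
  intro d N L ℓ p T F η ε u w 𝒰 H Ht R Rh prec x b hd hℓ hp hη hu huε h𝒰 hH hA hpε hprec hw hNw
    hprod
  have hε : 0 < ε := hu.trans huε
  have hc : 1 / (1000 * (1 + κ)) ≤ 1 / 1000 :=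
    one_div_le_one_div_of_le (by norm_num) (by linarith)
  have hp1 : 1 ≤ √(p : ℝ) := Real.one_le_sqrt.2 (by exact_mod_cast hp)
  have hεc : ε ≤ 1 / (1000 * (1 + κ)) := (le_mul_of_one_le_left hε.le hp1).trans hpε
  have hκu : κ * u ≤ 1 / 1000 := by
    calc κ * u ≤ κ * (1 / (1000 * (1 + κ))) := by
          gcongr
          exact huε.le.trans hεc
      _ = κ / (1 + κ) * (1 / 1000) := by field_simp
      _ ≤ 1 * (1 / 1000) := by
          gcongr
          exact (div_le_one (by linarith)).2 (by linarith)
      _ = _ := one_mul _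
  obtain ⟨S, y, hS, hy, hacc⟩ := hprod.exists_products hd hη hℓ hw
  set K := ℓ * constFar d η + constNeighbor d η + ((L : ℝ) - ℓ) * constAdjacent d with hK
  have hK2 : 2 ≤ K := two_le_block_constant hd hη hℓ
  set G := (1 + w) ^ N - 1 with hG
  have hG0 : 0 ≤ G := sub_nonneg.2 (one_le_one_add_pow hw N)
  have hε1 : ε ≤ 1 / 1000 := hεc.trans hc
  have hG1 : G ≤ 1.001 * ε :=
    (one_add_pow_sub_one_le hw hNw (by linarith)).trans (by nlinarith)
  set v : (B : Block d) → T.rows B → ℝ := fun B => T.sub H B *ᵥ T.restrictCols x B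
  -- The accumulation error is `G` times the sum of the `|y B|`, and `|y B| ≤ |y B - v B| + |v B|`.
  set e : (B : Block d) → T.rows B → ℝ := fun B i => (1 + G) * |y B i - v B i| + G * |v B i|
  set h : Block d → ℝ := fun B => ‖T.sub H B‖
  set s : Block d → ℝ := blockWeight F
  have he : ∀ B ∈ S, vecNorm (e B) ≤
      (2.04 * ε * ‖H‖ * s B + 3.06 * ε * h B) * vecNorm (T.restrictCols x B) := by
    intro B hB
    have h1 := vecNorm_block_error_le hH hA hd hη hℓ hS hu huε h𝒰 hp hκu (hpε.trans hc)
      (fun B h1 h2 => (hprec B h1 h2).trans hc) hw hNw hB (hy B hB)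
    have h2 : vecNorm (v B) ≤ h B * vecNorm (T.restrictCols x B) := vecNorm_mulVec_le _ _
    have h3 := vecNorm_add_le (fun i => (1 + G) * |y B i - v B i|) (fun i => G * |v B i|)
    rw [vecNorm_smul, vecNorm_smul, vecNorm_abs (v B), vecNorm_abs fun i => y B i - v B i,
      abs_of_nonneg hG0, abs_of_nonneg (by linarith : 0 ≤ 1 + G)] at h3
    have hn := vecNorm_nonneg (T.restrictCols x B)
    set n := vecNorm (T.restrictCols x B)
    have hs : 0 ≤ s B := blockWeight_nonneg F B
    have hh : 0 ≤ h B := norm_nonneg _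
    have h4 : (1 + G) * vecNorm (fun i => y B i - v B i) ≤
        1.0011 * (1.0122 * (2 * ε * (s B * ‖H‖) + 2 * ε * h B) * n) := by
      refine mul_le_mul (by linarith) h1 (vecNorm_nonneg _) (by norm_num)
    have h5 : G * vecNorm (v B) ≤ 1.001 * ε * (h B * n) :=
      mul_le_mul hG1 h2 (vecNorm_nonneg _) (by positivity)
    have h6 : 0 ≤ ε * (s B * ‖H‖) * n := by positivity
    have h7 : 0 ≤ ε * h B * n := by positivity
    refine h3.trans ((add_le_add h4 h5).trans ?_)
    linarith
  have hsum : ∑ B ∈ S, (2.04 * ε * ‖H‖ * s B + 3.06 * ε * h B) ^ 2 ≤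
      (2.04 * ε * ‖H‖ * √(2 * K) + 3.06 * ε * ‖H‖) ^ 2 := by
    refine sum_add_sq_le (by positivity) (by positivity) ?_ ?_
    · simp_rw [mul_pow _ (s _), mul_pow _ (√_)]
      rw [← Finset.mul_sum, Real.sq_sqrt (by linarith)]
      gcongr
      exact hH.sum_blockWeight_sq_le hd hη hℓ hS
    · simp_rw [mul_pow _ (h _), mul_pow _ ‖H‖]
      rw [← Finset.mul_sum, T.sum_norm_sub_sq hd hη hℓ hS]
  have hagg := T.vecNorm_sum_extend_le hd hη hℓ hS (by positivity) he hsum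
  have hres : ∀ r, |b r - (H *ᵥ x) r| ≤ ∑ B ∈ S, |T.extend B (e B) r| := by
    intro r
    have h1 : ∀ B, T.extend B (e B) r =
        (1 + G) * |T.extend B (y B) r - T.extend B (v B) r| + G * |T.extend B (v B) r| := by
      intro B
      by_cases hr : r ∈ T.rows B
      · simp only [T.extend_of_mem _ hr, e]
      · simp [T.extend_of_notMem _ hr]
    have h2 : ∀ B, |T.extend B (e B) r| = T.extend B (e B) r := fun B =>
      abs_of_nonneg (by rw [h1]; positivity)
    simp_rw [h2, h1]
    rw [Finset.sum_add_distrib, ← Finset.mul_sum, ← Finset.mul_sum,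
      T.mulVec_eq_sum_blocks hd hη hℓ hS H x r]
    have h3 : |∑ B ∈ S, T.extend B (y B) r - ∑ B ∈ S, T.extend B (v B) r| ≤
        ∑ B ∈ S, |T.extend B (y B) r - T.extend B (v B) r| := by
      rw [← Finset.sum_sub_distrib]
      exact Finset.abs_sum_le_sum_abs _ _
    have h4 : ∑ B ∈ S, |T.extend B (y B) r| ≤
        ∑ B ∈ S, |T.extend B (y B) r - T.extend B (v B) r| + ∑ B ∈ S, |T.extend B (v B) r| := by
      rw [← Finset.sum_add_distrib]
      refine Finset.sum_le_sum fun B _ => ?_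
      have := abs_add_le (T.extend B (y B) r - T.extend B (v B) r) (T.extend B (v B) r)
      rwa [sub_add_cancel] at this
    have h5 := mul_le_mul_of_nonneg_left h4 hG0
    have h6 := abs_sub_le (b r) (∑ B ∈ S, T.extend B (y B) r) (∑ B ∈ S, T.extend B (v B) r)
    have h7 := hacc r
    linarith
  -- Since `2.04 * 1.4143 < 2.89`, at least `1.11 √K` is to spare, and `√K ≥ 1.4` makes this exceed
  -- the excess `3.06 - 2`.
  have hfinal : 2.04 * ε * ‖H‖ * √(2 * K) + 3.06 * ε * ‖H‖ ≤
      2 * (2 * √K + 1) * ε * ‖H‖ := by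
    have h1 : √(2 * K) ≤ 1.4143 * √K := by
      rw [Real.sqrt_mul zero_le_two]
      gcongr
      rw [Real.sqrt_le_left (by norm_num)]
      norm_num
    have h2 : 1.4 ≤ √K := Real.le_sqrt_of_sq_le (by norm_num; linarith)
    have h3 : 2.04 * √(2 * K) + 3.06 ≤ 2 * (2 * √K + 1) := by linarith
    have h4 := mul_le_mul_of_nonneg_right h3 (by positivity : 0 ≤ ε * ‖H‖)
    linarith
  obtain ⟨E, hE, hEn⟩ := exists_mulVec_eq_of_vecNorm_le (m := Fin N) (r := b - H *ᵥ x)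
    (by positivity) ((vecNorm_mono fun r => (hres r).trans (le_abs_self _)).trans hagg)
  exact ⟨E, by rw [Matrix.add_mulVec, hE, add_sub_cancel], hEn.trans hfinal⟩
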